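/- Notation. Integrals over $\mathbb S^2$ are with respect to surface measure (total mass $4\pi$). Let $\mathrm{Sym}_0(3)$ be the space of traceless symmetric real $3\times3$ matrices with $A\cdot B=\sum_{i,j}A_{ij}B_{ij}$, $|A|^2=A\cdot A$, and let $\mathcal P(\mathbb S^2)=\{f\in L^1(\mathbb S^2): f\ge 0 \text{ a.e.},\ \int f=1\}$. For $f\in\mathcal P(\mathbb S^2)$ put $Q_f=\int_{\mathbb S^2}f(p)\,(p\otimes p-\tfrac13 I)\,dp$. For $\eta\in\mathbb R$ and $\tau>0$ let $$\mathcal F(f)=\int_{\mathbb S^2} f\ln f-f\ln(Q_fp\cdot p-\eta)\,dp\in\mathbb R\cup\{+\infty\},\qquad \mathcal F_\tau(f)=\mathcal F(f)-\frac1{2\tau}|Q_f|^2,$$ where $-\ln:=+\infty$ on $(-\infty,0]$ and $0\cdot\infty=0$. For $Q\in\mathrm{Sym}_0(3)$ let $J(Q)=\inf\{\mathcal F(f): f\in\mathcal P(\mathbb S^2),\ Q_f=Q\}$ (so $J(Q)=+\infty$ if there is no such $f$), $\mathrm{dom}(J)=\{Q: J(Q)<+\infty\}$, and $J_\tau(Q)=J(Q)-\frac1{2\tau}|Q|^2$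 on $\mathrm{dom}(J)$. For $p\in[1,\infty]$, an $L^p$-local minimiser is an $f^*\in\mathcal P(\mathbb S^2)$ with $\mathcal F_\tau(f^*)<+\infty$ such that, for some $\varepsilon>0$, $\mathcal F_\tau(f^*)\le\mathcal F_\tau(g)$ for all $g\in\mathcal P(\mathbb S^2)$ with $\|g-f^*\|_{L^p}<\varepsilon$. Theorem. Let $\eta\in\mathbb R$ and $\tau>0$. (1) If $f^*$ is an $L^p$-local minimiser for some $p\in[1,\infty]$, then it is an $L^q$-local minimiser for every $q\in[1,\infty]$. (2) For every $L^p$-local minimiser $f^*$ there are $Q^*,\lambda^*\in\mathrm{Sym}_0(3)$ and $Z>0$ with $$f^*(p)=\frac1Z\exp(\lambda^*p\cdot p)\max(Q^*p\cdot p-\eta,0)\ \text{ for a.e. }p,\qquad Q^*=\int_{\mathbb S^2}f^*(p)\Big(p\otimes p-\frac13I\Big)dp,$$ $$\lambda^*=\int_{\mathbb S^2}\frac{f^*(p)}{Q^*p\cdot p-\eta}\Big(p\otimes p-\frac13I\Big)dp+\frac1\tau Q^*$$ (the last integral being absolutely convergent, its integrand read as $0$ where $Q^*p\cdot p\le\eta$).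 Moreover $Q^*$ is an interior point of $\mathrm{dom}(J)$ and $(Q^*,\lambda^*)$ is a saddle point of $$F(Q,\lambda)=Q\cdot\lambda-\frac1{2\tau}|Q|^2-\ln\int_{\mathbb S^2}\exp(\lambda p\cdot p)\max(Qp\cdot p-\eta,0)\,dp,\qquad (Q,\lambda)\in\mathrm{dom}(J)\times\mathrm{Sym}_0(3),$$ in the following sense: $F$ is differentiable at $(Q^*,\lambda^*)$ with zero derivative, $\lambda^*$ maximises $F(Q^*,\cdot)$ over $\mathrm{Sym}_0(3)$, and $Q^*$ is a local minimiser on $\mathrm{dom}(J)$ of $Q\mapsto\max_\lambda F(Q,\lambda)$, the maximum being attained for all $Q\in\mathrm{dom}(J)$ near $Q^*$. (3) Let $\eta<0$. Then $0$ is an interior point of $\mathrm{dom}(J)$, $J$ is $C^2$ near $0$ with $$\partial^2J(0)=\frac{15}2\Big(1+\frac2{15\eta}\Big)^2\mathrm{Id},$$ and $Q=0$ is a critical point of $J_\tau$. Let $\tau_c=\Big(\frac{15}2\big(1+\frac2{15\eta}\big)^2\Big)^{-1}\in(0,\infty]$ (with $\tau_c=\infty$ if $\eta=-\frac2{15}$).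 If $\tau>\tau_c$, then $0$ is a local minimum of $J_\tau$, and the isotropic state $f_u=\frac1{4\pi}$ is an $L^p$-local minimiser for every $p\in[1,\infty]$. If $\tau<\tau_c$, then $0$ is a local maximum of $J_\tau$, and $f_u$ is not an $L^p$-local minimiser for any $p\in[1,\infty]$. -/

import Mathlib

open MeasureTheory Filter Topology
open scoped ENNReal

namespace ThermalNematic

noncomputable section

/-- The unit sphere of `ℝ³`. -/
abbrev S2 : Type := Metric.sphere (0 : EuclideanSpace ℝ (Fin 3)) 1

/-- The surface measure on the unit sphere (total mass `4π`), i.e. the two-dimensional Hausdorff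
measure in its usual normalisation. -/
def surf : Measure S2 := (volume : Measure (EuclideanSpace ℝ (Fin 3))).toSphere

/-- The subspace of traceless symmetric real `3 × 3` matrices. -/
def symTraceless : Submodule ℝ (Matrix (Fin 3) (Fin 3) ℝ) where
  carrier := {A | A.transpose = A ∧ A.trace = 0}
  add_mem' := by
    rintro A B ⟨hA, hA'⟩ ⟨hB, hB'⟩
    exact ⟨by rw [Matrix.transpose_add, hA, hB], by rw [Matrix.trace_add, hA', hB', add_zero]⟩
  zero_mem' := ⟨Matrix.transpose_zero, Matrix.trace_zero _ _⟩
  smul_mem' := by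
    rintro c A ⟨hA, hA'⟩
    exact ⟨by rw [Matrix.transpose_smul, hA], by rw [Matrix.trace_smul, hA', smul_zero]⟩

/-- The space of traceless symmetric real `3 × 3` matrices, as a type of its own (so that its only
topology is that of the Frobenius norm). -/
def SymZ : Type := symTraceless

section
attribute [local instance] Matrix.frobeniusNormedAddCommGroup Matrix.frobeniusNormedSpace

instance : NormedAddCommGroup SymZ := inferInstanceAs (NormedAddCommGroup symTraceless)

instance : NormedSpace ℝ SymZ := inferInstanceAs (NormedSpace ℝ symTraceless)

instance : FiniteDimensional ℝ SymZ := inferInstanceAs (FiniteDimensional ℝ symTraceless)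

end

/-- The Frobenius inner product `A · B = ∑ᵢⱼ Aᵢⱼ Bᵢⱼ`. -/
def dot (A B : SymZ) : ℝ := ∑ i, ∑ j, A.1 i j * B.1 i j

/-- The quadratic form `A p · p`. -/
def quad (A : SymZ) (p : S2) : ℝ := ∑ i, ∑ j, A.1 i j * (p.1 i * p.1 j)

/-- The tensor `p ⊗ p - I / 3`. -/
def mom (p : S2) : SymZ :=
  ⟨Matrix.of (fun i j => p.1 i * p.1 j) - (1 / 3 : ℝ) • (1 : Matrix (Fin 3) (Fin 3) ℝ), by
    refine ⟨?_, ?_⟩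
    · ext i j
      simp [Matrix.one_apply, mul_comm, eq_comm]
    · have h : ‖p.1‖ = 1 := by simp
      have h2 : ‖p.1‖ ^ 2 = 1 := by rw [h]; norm_num
      rw [EuclideanSpace.norm_sq_eq] at h2
      simp only [Fin.sum_univ_three, Real.norm_eq_abs, sq_abs] at h2
      simp only [Matrix.trace, Matrix.diag, Fin.sum_univ_three, Matrix.sub_apply, Matrix.of_apply,
        Matrix.smul_apply, Matrix.one_apply_eq, smul_eq_mul]
      linarith⟩

/-- `f` is (a representative of) a probability density on the sphere. -/
def IsDensity (f : S2 → ℝ) : Prop :=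
  Integrable f surf ∧ (∀ᵐ p ∂surf, 0 ≤ f p) ∧ ∫ p, f p ∂surf = 1

/-- The Q-tensor of `f`. -/
def qTensor (f : S2 → ℝ) : SymZ := ∫ p, f p • mom p ∂surf

open Classical in
/-- The free energy `∫ f ln f - f ln (Q p · p - η)`, where `Q` is the Q-tensor of `f`, `-ln` is
`+∞` on `(-∞, 0]`, and `0 · ∞ = 0`. If `f > 0` on a non-null subset of `{Q p · p ≤ η}` the value is
`+∞`. Otherwise, for a density `f`, the negative part of the integrand is integrable (`t ln t` is
bounded below and `Q p · p - η` is bounded above), so that the integral is the Bochner integral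
where the integrand is integrable, and `+∞` where it is not. -/
def energy (η : ℝ) (f : S2 → ℝ) : EReal :=
  if (∀ᵐ p ∂surf, 0 < f p → η < quad (qTensor f) p) ∧
      Integrable
        (fun p => f p * Real.log (f p) - f p * Real.log (quad (qTensor f) p - η)) surf then
    ((∫ p, (f p * Real.log (f p) - f p * Real.log (quad (qTensor f) p - η)) ∂surf : ℝ) : EReal)
  else ⊤

/-- The thermal energy `F_τ(f) = F(f) - |Q|² / (2 τ)`. -/
def energyT (η τ : ℝ) (f : S2 → ℝ) : EReal :=
  energy η f - ((1 / (2 * τ) * dot (qTensor f) (qTensor f) : ℝ) : EReal)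

/-- `f` is a (finite energy) local minimiser of the thermal energy among the probability densities,
with respect to the `L^r` distance. -/
def IsLpLocalMin (η τ : ℝ) (r : ℝ≥0∞) (f : S2 → ℝ) : Prop :=
  IsDensity f ∧ energyT η τ f < ⊤ ∧
    ∃ ε : ℝ, 0 < ε ∧ ∀ g : S2 → ℝ, IsDensity g →
      eLpNorm (fun p => g p - f p) r surf < ENNReal.ofReal ε → energyT η τ f ≤ energyT η τ g

/-- The macroscopic energy `J(Q)`: the infimum of the energy over the densities with Q-tensor `Q`
(it is `+∞` if there are none, in particular if `Q` has an eigenvalue `≤ -1/3`). -/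
def J (η : ℝ) (Q : SymZ) : EReal :=
  ⨅ (f : S2 → ℝ) (_ : IsDensity f ∧ qTensor f = Q), energy η f

/-- The effective domain of `J`. -/
def domJ (η : ℝ) : Set SymZ := {Q | J η Q < ⊤}

/-- `J` as a real function; meaningful on `domJ η` (where `J` is finite). -/
def Jreal (η : ℝ) (Q : SymZ) : ℝ := (J η Q).toReal

/-- `J_τ(Q) = J(Q) - |Q|² / (2 τ)`; meaningful on `domJ η`. -/
def Jthermal (η τ : ℝ) (Q : SymZ) : ℝ := Jreal η Q - 1 / (2 * τ) * dot Q Q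

/-- The dual function
`F(Q, Λ) = Q · Λ - |Q|² / (2 τ) - ln (∫ exp (Λ p · p) max (Q p · p - η, 0) dp)`. -/
def dualF (η τ : ℝ) (x : SymZ × SymZ) : ℝ :=
  dot x.1 x.2 - 1 / (2 * τ) * dot x.1 x.1
    - Real.log (∫ p, Real.exp (quad x.2 p) * max (quad x.1 p - η) 0 ∂surf)

/-- The modified Euler–Lagrange system for `(f, Q, Λ)`. (Where `Q p · p ≤ η` the first equation
gives `f p = 0`, and the quotient in the last one is read as `0`.) -/
def SolvesEulerLagrange (η τ : ℝ) (f : S2 → ℝ) (Q Λ : SymZ) : Prop :=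
  (∃ Z : ℝ, 0 < Z ∧
    ∀ᵐ p ∂surf, f p = 1 / Z * Real.exp (quad Λ p) * max (quad Q p - η) 0) ∧
  Q = ∫ p, f p • mom p ∂surf ∧
  Integrable (fun p => (f p / (quad Q p - η)) • mom p) surf ∧
  Λ = ∫ p, (f p / (quad Q p - η)) • mom p ∂surf + (1 / τ) • Q

/-- `(Q, Λ)` is a saddle point of `F : D × SymZ → ℝ`: a critical point of `F` which is a local
solution of the saddle point problem `min_{Q₀ ∈ D} max_M F(Q₀, M)`, that is, `Λ` maximises
`F(Q, ·)`, and `Q` is a local minimiser of `Q₀ ↦ max_M F(Q₀, M)`, the maximum being attained. -/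
structure IsSaddlePoint (F : SymZ × SymZ → ℝ) (D : Set SymZ) (Q Λ : SymZ) : Prop where
  mem : Q ∈ D
  nhds : D ∈ 𝓝 Q
  critical : HasFDerivAt F (0 : SymZ × SymZ →L[ℝ] ℝ) (Q, Λ)
  max : ∀ M : SymZ, F (Q, M) ≤ F (Q, Λ)
  min : ∀ᶠ Q₀ in 𝓝[D] Q, ∃ M₀ : SymZ, (∀ M : SymZ, F (Q₀, M) ≤ F (Q₀, M₀)) ∧
    F (Q, Λ) ≤ F (Q₀, M₀)

/-- The isotropic state. -/
def isotropic : S2 → ℝ := fun _ => 1 / (4 * Real.pi)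

/-- The coefficient `(15/2) (1 + 2/(15 η))²` of the Hessian of `J` at `0`. -/
def hessCoeff (η : ℝ) : ℝ := 15 / 2 * (1 + 2 / (15 * η)) ^ 2

/-- The critical temperature `τ_c = ((15/2) (1 + 2/(15 η))²)⁻¹ ∈ (0, ∞]`, equal to `∞` exactly
when `1 + 2/(15 η) = 0`. -/
def tauCrit (η : ℝ) : ℝ≥0∞ := (ENNReal.ofReal (hessCoeff η))⁻¹

end

end ThermalNematic

/-!
The free energy at a fixed Q-tensor `Q` is the relative entropy with respect to the weight
`w = max (Q p · p - η, 0)`. By the Gibbs inequality it is at least `Q · Λ - ln Z(Q, Λ)` for every `Λ`,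
where `Z(Q, Λ) = ∫ exp (Λ p · p) w dp`, with equality only for the Gibbs density
`exp (Λ p · p) w / Z` (`gibbs_inequality`). A pair `(Q, Λ)` whose Gibbs density has Q-tensor `Q` is
called a dual pair (`IsDual`). For a dual pair `J(Q) = Q · Λ - ln Z(Q, Λ)`, the infimum being attained
by the Gibbs density, and `Λ` maximises the dual function. If some density supported in
`{η < Q p · p}` has Q-tensor `Q`, a dual pair exists, since `∫ exp (Λ p · p - Q · Λ) w dp` is then
coercive in `Λ` (`exists_isDual`); here and below it matters that the level sets of quadratic forms
on the sphere are null (`surf_quad_eq_null`).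

Integration against `w`, as a functional on the continuous functions of the sphere, is strictly
differentiable in `Q` despite the kink of `w` (`hasStrictFDerivAt_wInt`). Dual pairs are the zeros of
a strictly differentiable map (`defect`) whose derivative in `Λ` is a covariance form, hence
invertible. The implicit function theorem therefore gives a continuous branch of dual pairs near
each one (`IsDual.exists_branch`): the domain of `J` is open, the Gibbs densities depend continuously
on `Q` in the uniform norm, and the envelope theorem gives the derivative of `J`
(`IsDual.hasFDerivAt_Jreal`).

The key point is that, for every exponent, local minimisers of the free energy are exactly the Gibbs
densities of the local minimisers of `J_τ` (`isLpLocalMin_iff`); its right hand side does not mention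
the exponent. An `L^r`-local minimiser is an `L^∞`-local one. It is a Gibbs density, as otherwise a
bounded perturbation with the same Q-tensor lowers the energy, by convexity
(`exists_bounded_competitor`), and then continuity of the Gibbs densities in `Q` makes its Q-tensor a
local minimiser of `J_τ`. Conversely the Q-tensor is continuous in `L¹`. The Euler–Lagrange system and
the saddle point property express that the derivative of `J_τ` vanishes.

For `η < 0` the weight is affine in `Q` near `0`, so that everything is smooth there. The Hessian of
`J` at `0` follows from the derivative of the branch of dual pairs at `0` and the fourth moments of the
surface measure (`contDiffAt_Jreal_and_hessian`), and the sign of `∂²J(0) - 1 / τ` decides the rest.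
-/

namespace ThermalNematic

noncomputable section

/-! ### The Frobenius inner product on traceless symmetric matrices -/

theorem SymZ.coe_add (A B : SymZ) : (A + B).1 = A.1 + B.1 := rfl

theorem SymZ.coe_smul (c : ℝ) (A : SymZ) : (c • A).1 = c • A.1 := rfl

theorem SymZ.coe_zero : (0 : SymZ).1 = 0 := rfl

theorem SymZ.trace_eq_zero (A : SymZ) : A.1 0 0 + A.1 1 1 + A.1 2 2 = 0 := by
  have h := A.2.2
  simpa [Matrix.trace, Fin.sum_univ_three] using h

theorem SymZ.symm_apply (A : SymZ) (i j : Fin 3) : A.1 i j = A.1 j i :=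
  congrFun (congrFun A.2.1 j) i

theorem dot_comm (A B : SymZ) : dot A B = dot B A := by
  simp only [dot, mul_comm]

theorem dot_add_left (A B C : SymZ) : dot (A + B) C = dot A C + dot B C := by
  simp only [dot, SymZ.coe_add, Matrix.add_apply, add_mul, Finset.sum_add_distrib]

theorem dot_smul_left (c : ℝ) (A B : SymZ) : dot (c • A) B = c * dot A B := by
  simp only [dot, SymZ.coe_smul, Matrix.smul_apply, smul_eq_mul, mul_assoc, Finset.mul_sum]

theorem dot_self_eq_norm_sq (A : SymZ) : dot A A = ‖A‖ ^ 2 := by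
  let := Matrix.frobeniusNormedAddCommGroup (m := Fin 3) (n := Fin 3) (α := ℝ)
  have h : ‖A‖ = ‖A.1‖ := rfl
  rw [h, Matrix.frobenius_norm_def, ← Real.sqrt_eq_rpow, Real.sq_sqrt (by positivity)]
  simp [dot, pow_two]

/-- The Frobenius inner product, as an inner product space structure on `SymZ` inducing its
norm. It is only used locally, so that the normed space structure of `SymZ` remains the global one. -/
abbrev symZInner : InnerProductSpace ℝ SymZ where
  inner A B := dot A B
  norm_sq_eq_re_inner A := by simp [dot_self_eq_norm_sq]
  conj_inner_symm A B := by simp [dot_comm]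
  add_left := dot_add_left
  smul_left A B c := by simp [dot_smul_left]

/-- The Frobenius inner product as a continuous bilinear form. -/
def dotL : SymZ →L[ℝ] SymZ →L[ℝ] ℝ :=
  letI := symZInner
  innerSL ℝ

@[simp] theorem dotL_apply (A B : SymZ) : dotL A B = dot A B := rfl

theorem dotL_injective : Function.Injective dotL := by
  intro A B h
  have h2 : dotL (A - B) (A - B) = 0 := by
    rw [map_sub dotL, h, sub_self, zero_apply]
  rw [dotL_apply, dot_self_eq_norm_sq] at h2
  exact sub_eq_zero.1 (norm_eq_zero.1 (pow_eq_zero_iff (two_ne_zero) |>.1 h2))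

theorem ext_dot {A B : SymZ} (h : ∀ M, dot A M = dot B M) : A = B :=
  dotL_injective (ContinuousLinearMap.ext h)

theorem dot_zero_left (A : SymZ) : dot 0 A = 0 := by
  have := dotL.map_zero
  rw [← dotL_apply, this]; rfl

theorem abs_dot_le (A B : SymZ) : |dot A B| ≤ ‖A‖ * ‖B‖ :=
  letI := symZInner
  abs_real_inner_le_norm A B

theorem dot_mom (p : S2) (M : SymZ) : dot (mom p) M = quad M p := by
  have h := M.trace_eq_zero
  simp only [dot, quad, mom, Matrix.sub_apply, Matrix.of_apply, Matrix.smul_apply, smul_eq_mul,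
    Fin.sum_univ_three, Matrix.one_apply]
  simp
  linear_combination (-1 / 3) * h

theorem sphere_sum_sq (p : S2) : p.1 0 ^ 2 + p.1 1 ^ 2 + p.1 2 ^ 2 = 1 := by
  have h : ‖p.1‖ = 1 := by simp
  have h2 : ‖p.1‖ ^ 2 = 1 := by rw [h]; norm_num
  rw [EuclideanSpace.norm_sq_eq] at h2
  simpa only [Fin.sum_univ_three, Real.norm_eq_abs, sq_abs] using h2

theorem norm_mom_le (p : S2) : ‖mom p‖ ≤ 1 := by
  have h := sphere_sum_sq p
  have h2 : ‖mom p‖ ^ 2 ≤ 1 := by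
    rw [← dot_self_eq_norm_sq, dot_mom]
    simp only [quad, mom, Matrix.sub_apply, Matrix.of_apply, Matrix.smul_apply, smul_eq_mul,
      Fin.sum_univ_three, Matrix.one_apply]
    simp
    have : (p.1 0 ^ 2 + p.1 1 ^ 2 + p.1 2 ^ 2) ^ 2 = 1 := by rw [h]; norm_num
    nlinarith
  exact (sq_le_one_iff₀ (norm_nonneg _)).1 h2

theorem continuous_coord (i : Fin 3) : Continuous fun p : S2 => p.1 i := by
  fun_prop

theorem continuous_quad (A : SymZ) : Continuous (quad A) := by
  unfold quad
  fun_prop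

theorem abs_quad_le (A : SymZ) (p : S2) : |quad A p| ≤ ‖A‖ := by
  rw [← dot_mom]
  refine (abs_dot_le _ _).trans ?_
  nlinarith [norm_mom_le p, norm_nonneg A]

theorem quad_add (A B : SymZ) (p : S2) : quad (A + B) p = quad A p + quad B p := by
  simp only [← dot_mom, ← dotL_apply, map_add]

theorem quad_smul (c : ℝ) (A : SymZ) (p : S2) : quad (c • A) p = c * quad A p := by
  simp only [← dot_mom, ← dotL_apply, map_smul, smul_eq_mul]

theorem quad_sub (A B : SymZ) (p : S2) : quad (A - B) p = quad A p - quad B p := by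
  simp only [← dot_mom, ← dotL_apply, map_sub]

theorem quad_zero (p : S2) : quad 0 p = 0 := by
  simp only [← dot_mom, ← dotL_apply, map_zero]

theorem continuous_mom : Continuous mom := by
  rw [continuous_iff_continuousAt]
  let := symZInner
  intro p
  have h : ∀ q, ‖mom q - mom p‖ ^ 2 = quad (mom q) q - 2 * quad (mom p) q + quad (mom p) p := by
    intro q
    rw [← dot_self_eq_norm_sq, ← dot_mom, ← dot_mom, ← dot_mom]
    simp only [← dotL_apply, map_sub, sub_apply]
    simp only [dotL_apply]
    rw [dot_comm (mom p) (mom q)]; ring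
  have hc : Continuous fun q : S2 => quad (mom q) q - 2 * quad (mom p) q + quad (mom p) p := by
    have h1 : Continuous fun q : S2 => quad (mom q) q := by
      simp only [quad, mom, Matrix.sub_apply, Matrix.of_apply, Matrix.smul_apply, smul_eq_mul]
      fun_prop
    exact (h1.sub (continuous_const.mul (continuous_quad _))).add continuous_const
  have h0 := hc.tendsto p
  simp only [← h, sub_self, norm_zero] at h0
  rw [ContinuousAt, tendsto_iff_norm_sub_tendsto_zero]
  have := h0.sqrt
  simpa [Real.sqrt_sq (norm_nonneg _)] using this

/-! ### The surface measure -/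

instance : IsFiniteMeasure surf := inferInstanceAs (IsFiniteMeasure (Measure.toSphere _))

instance : surf.IsOpenPosMeasure := inferInstanceAs (Measure.IsOpenPosMeasure (Measure.toSphere _))

theorem surf_real_univ : surf.real Set.univ = 4 * Real.pi := by
  rw [surf, Measure.toSphere_real_apply_univ, Measure.real, EuclideanSpace.volume_ball_fin_three]
  simp only [finrank_euclideanSpace, Fintype.card_fin, ENNReal.ofReal_one, one_pow, one_mul]
  rw [ENNReal.toReal_ofReal (by positivity)]
  push_cast
  ring

/-- A level set of a quadratic form `A p · p` on the sphere is null, except for the trivial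
level set `{0 = 0}`: it spans a cone on which a nonzero quadratic form vanishes, and along lines in
a direction where this form does not vanish it has finitely many zeros. -/
theorem surf_quad_eq_null (A : SymZ) (c : ℝ) (h : A ≠ 0 ∨ c ≠ 0) :
    surf {p | quad A p = c} = 0 := by
  let B : EuclideanSpace ℝ (Fin 3) → ℝ := fun x =>
    ∑ i, ∑ j, A.1 i j * (x i * x j) - c * ∑ i, x i ^ 2
  have hBc : Continuous B := by fun_prop
  have hv : ∃ v, B v ≠ 0 := by
    by_contra! hB
    have hd : ∀ i, A.1 i i = c := by
      intro i
      have := hB (EuclideanSpace.single i 1)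
      fin_cases i <;> simp [B, Fin.sum_univ_three] at this ⊢ <;> linarith
    have ht := A.trace_eq_zero
    have hc : c = 0 := by rw [hd, hd, hd] at ht; linarith
    have ho : ∀ i j, A.1 i j = 0 := by
      intro i j
      by_cases hij : i = j
      · rw [hij, hd, hc]
      have h1 := hB (EuclideanSpace.single i 1 + EuclideanSpace.single j 1)
      have h2 := A.symm_apply i j
      have hd' : ∀ i, A.1 i i = 0 := fun i => by rw [hd, hc]
      have d0 := hd' 0
      have d1 := hd' 1
      have d2 := hd' 2
      fin_cases i <;> fin_cases j <;> simp [B, Fin.sum_univ_three, hc] at h1 h2 hij ⊢ <;> linarith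
    rcases h with h | h
    · exact h (Subtype.ext (Matrix.ext ho))
    · exact h hc
  obtain ⟨v, hv⟩ := hv
  have hT : volume {x | B x = 0} = 0 := by
    have hms : MeasurableSet {x | B x ≠ 0} := (isOpen_ne_fun hBc continuous_const).measurableSet
    have := ae_mem_of_ae_add_linearMap_mem
      (LinearMap.toSpanSingleton ℝ (EuclideanSpace ℝ (Fin 3)) v) volume volume hms ?_
    · simpa [ae_iff] using this
    · intro y
      rw [ae_iff]
      obtain ⟨β, hβ⟩ : ∃ β, ∀ t : ℝ, B (y + t • v) = B y + t * β + t ^ 2 * B v := by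
        refine ⟨∑ i, ∑ j, A.1 i j * (y i * v j + v i * y j) - c * ∑ i, 2 * (y i * v i), fun t => ?_⟩
        simp only [B, Fin.sum_univ_three, PiLp.add_apply, PiLp.smul_apply, smul_eq_mul]
        ring
      let q : Polynomial ℝ := Polynomial.C (B v) * Polynomial.X ^ 2
        + Polynomial.C β * Polynomial.X + Polynomial.C (B y)
      have hq : q ≠ 0 := by
        intro h0
        apply hv
        have := congrArg (fun r => Polynomial.coeff r 2) h0
        simpa [q, Polynomial.coeff_X, Polynomial.coeff_C] using this
      refine Set.Finite.measure_zero (q.roots.toFinset.finite_toSet.subset ?_) _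
      intro t ht
      simp only [Set.mem_ofPred_eq, not_not, LinearMap.toSpanSingleton_apply] at ht
      have ht' : B (y + t • v) = 0 := by simpa using ht
      rw [hβ] at ht'
      simp only [Finset.mem_coe, Multiset.mem_toFinset, Polynomial.mem_roots hq,
        Polynomial.IsRoot.def, q]
      simp
      linarith
  have hm : MeasurableSet {p : S2 | quad A p = c} :=
    (isClosed_eq (continuous_quad A) continuous_const).measurableSet
  rw [surf, Measure.toSphere_apply' _ hm]
  refine mul_eq_zero_of_right _ (measure_mono_null ?_ hT)
  rintro x hx
  obtain ⟨r, -, y, ⟨p, hp, rfl⟩, rfl⟩ := Set.mem_smul.1 hx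
  have h1 := sphere_sum_sq p
  simp only [Set.mem_ofPred_eq, quad] at hp
  simp only [Set.mem_ofPred_eq, B, PiLp.smul_apply, smul_eq_mul]
  simp only [Fin.sum_univ_three] at hp ⊢
  linear_combination r ^ 2 * hp - c * r ^ 2 * h1

open scoped Pointwise in
/-- The surface measure is invariant under linear isometries. -/
theorem measurePreserving_isometry
    (U : EuclideanSpace ℝ (Fin 3) ≃ₗᵢ[ℝ] EuclideanSpace ℝ (Fin 3)) :
    MeasurePreserving (fun p : S2 => (⟨U p.1, by simp⟩ : S2)) surf surf := by
  have hc : Continuous (fun p : S2 => (⟨U p.1, by simp⟩ : S2)) := by fun_prop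
  refine ⟨hc.measurable, ?_⟩
  ext s hs
  rw [Measure.map_apply hc.measurable hs, surf, Measure.toSphere_apply' _ (hc.measurable hs),
    Measure.toSphere_apply' _ hs]
  congr 1
  rw [← U.measurePreserving.measure_preimage_equiv (f := U.toMeasurableEquiv)
    (Set.Ioo (0 : ℝ) 1 • (Subtype.val '' s))]
  congr 1
  ext x
  simp only [Set.mem_smul, Set.mem_preimage]
  constructor
  · rintro ⟨r, hr, _, ⟨p, hp, rfl⟩, rfl⟩
    exact ⟨r, hr, _, ⟨_, hp, rfl⟩, by simp⟩
  · rintro ⟨r, hr, _, ⟨p, hp, rfl⟩, h⟩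
    replace h : r • p.1 = U x := h
    refine ⟨r, hr, U.symm p.1, ⟨⟨U.symm p.1, by simp⟩, ?_, rfl⟩, ?_⟩
    · simpa using hp
    · apply U.injective
      simp [h]

/-- Integrals over the sphere are invariant under the reflection in the plane orthogonal to
`(a, b, c)`. -/
theorem integral_reflect (F : ℝ → ℝ → ℝ → ℝ) (a b c s : ℝ) (hs : a ^ 2 + b ^ 2 + c ^ 2 = s) :
    ∫ p : S2, F (p.1 0 - 2 * (a * p.1 0 + b * p.1 1 + c * p.1 2) / s * a)
      (p.1 1 - 2 * (a * p.1 0 + b * p.1 1 + c * p.1 2) / s * b)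
      (p.1 2 - 2 * (a * p.1 0 + b * p.1 1 + c * p.1 2) / s * c) ∂surf
    = ∫ p : S2, F (p.1 0) (p.1 1) (p.1 2) ∂surf := by
  let v : EuclideanSpace ℝ (Fin 3) := !₂[a, b, c]
  let U := (ℝ ∙ v)ᗮ.reflection
  have hU : ∀ x i, U x i = x i - 2 * (a * x 0 + b * x 1 + c * x 2) / s * v i := by
    intro x i
    have : U x = x - (2 * (inner ℝ v x / ‖v‖ ^ 2)) • v := by
      rw [Submodule.reflection_orthogonal_apply, Submodule.reflection_singleton_apply]
      simp
      module
    rw [this, EuclideanSpace.norm_sq_eq]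
    simp [v, Fin.sum_univ_three, PiLp.inner_apply, ← hs]
    left
    ring
  have hc : Continuous (fun p : S2 => (⟨U p.1, by simp⟩ : S2)) := by fun_prop
  have hi : Function.Injective (fun p : S2 => (⟨U p.1, by simp⟩ : S2)) := by
    intro p q h
    exact Subtype.ext (U.injective (congrArg Subtype.val h))
  rw [← (measurePreserving_isometry U).integral_comp (hc.measurableEmbedding hi)
    (fun p : S2 => F (p.1 0) (p.1 1) (p.1 2))]
  simp only [hU]
  rfl

/-- The coordinate functions on the sphere. -/
def coordC (i : Fin 3) : C(S2, ℝ) := ⟨fun p => p.1 i, continuous_coord i⟩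

/-- Integration of continuous functions on the sphere against a finite measure. -/
def intL (μ : Measure S2) [IsFiniteMeasure μ] : C(S2, ℝ) →L[ℝ] ℝ :=
  LinearMap.mkContinuous
    { toFun := fun g => ∫ p, g p ∂μ
      map_add' := fun f g => integral_add (f.continuous.integrable_of_hasCompactSupport
        (HasCompactSupport.of_compactSpace _)) (g.continuous.integrable_of_hasCompactSupport
        (HasCompactSupport.of_compactSpace _))
      map_smul' := fun c f => by simp [integral_const_mul] }
    (μ.real Set.univ) (fun g => by
      rw [mul_comm]
      exact norm_integral_le_of_norm_le_const (Eventually.of_forall g.norm_coe_le_norm))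

@[simp] theorem intL_apply (μ : Measure S2) [IsFiniteMeasure μ] (g : C(S2, ℝ)) :
    intL μ g = ∫ p, g p ∂μ := rfl

/-- A traceless symmetric matrix as a continuous function on the sphere. -/
def quadL : SymZ →L[ℝ] C(S2, ℝ) :=
  LinearMap.mkContinuous
    { toFun := fun A => ⟨quad A, continuous_quad A⟩
      map_add' := fun A B => ContinuousMap.ext (quad_add A B)
      map_smul' := fun c A => ContinuousMap.ext (quad_smul c A) } 1 (fun A => by
      rw [one_mul, ContinuousMap.norm_le _ (norm_nonneg _)]
      exact abs_quad_le A)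

@[simp] theorem quadL_apply (A : SymZ) (p : S2) : quadL A p = quad A p := rfl

theorem integrable_continuousMap (μ : Measure S2) [IsFiniteMeasure μ] (g : C(S2, ℝ)) :
    Integrable g μ :=
  g.continuous.integrable_of_hasCompactSupport (HasCompactSupport.of_compactSpace _)

/-! ### Second and fourth moments of the surface measure -/

/-- The moment of a monomial of the coordinates. -/
def monoMoment (i j k : ℕ) : ℝ := ∫ p : S2, p.1 0 ^ i * p.1 1 ^ j * p.1 2 ^ k ∂surf

theorem monoMoment_eq_zero_of_odd (i j k : ℕ) (h : Odd i ∨ Odd j ∨ Odd k) :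
    monoMoment i j k = 0 := by
  unfold monoMoment
  have key : ∀ a b c : ℝ, a ^ 2 + b ^ 2 + c ^ 2 = 1 → (∀ x y z : ℝ,
      (x - 2 * (a * x + b * y + c * z) / 1 * a) ^ i * (y - 2 * (a * x + b * y + c * z) / 1 * b) ^ j *
      (z - 2 * (a * x + b * y + c * z) / 1 * c) ^ k = - (x ^ i * y ^ j * z ^ k)) →
      ∫ p : S2, p.1 0 ^ i * p.1 1 ^ j * p.1 2 ^ k ∂surf = 0 := by
    intro a b c hs hF
    have := integral_reflect (fun x y z => x ^ i * y ^ j * z ^ k) a b c 1 hs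
    simp only [hF] at this
    rw [integral_neg] at this
    linarith
  rcases h with h | h | h
  · refine key 1 0 0 (by norm_num) fun x y z => ?_
    rw [show x - 2 * (1 * x + 0 * y + 0 * z) / 1 * 1 = -x by ring, h.neg_pow]
    ring
  · refine key 0 1 0 (by norm_num) fun x y z => ?_
    rw [show y - 2 * (0 * x + 1 * y + 0 * z) / 1 * 1 = -y by ring, h.neg_pow]
    ring
  · refine key 0 0 1 (by norm_num) fun x y z => ?_
    rw [show z - 2 * (0 * x + 0 * y + 1 * z) / 1 * 1 = -z by ring, h.neg_pow]
    ring

theorem monoMoment_swap (i j k : ℕ) : monoMoment j i k = monoMoment i j k := by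
  unfold monoMoment
  rw [← integral_reflect (fun x y z => x ^ i * y ^ j * z ^ k) 1 (-1) 0 2 (by norm_num)]
  refine integral_congr_ae (Eventually.of_forall fun p => ?_)
  ring_nf

theorem monoMoment_swap' (i j k : ℕ) : monoMoment i k j = monoMoment i j k := by
  unfold monoMoment
  rw [← integral_reflect (fun x y z => x ^ i * y ^ j * z ^ k) 0 1 (-1) 2 (by norm_num)]
  refine integral_congr_ae (Eventually.of_forall fun p => ?_)
  ring_nf

theorem intL_monomial (i j k : ℕ) :
    intL surf (coordC 0 ^ i * coordC 1 ^ j * coordC 2 ^ k) = monoMoment i j k := rfl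

theorem coordC_sum_sq : coordC 0 ^ 2 + coordC 1 ^ 2 + coordC 2 ^ 2 = 1 :=
  ContinuousMap.ext sphere_sum_sq

theorem monoMoment_two : monoMoment 2 0 0 = 4 * Real.pi / 3 := by
  have h : intL surf (coordC 0 ^ 2 + coordC 1 ^ 2 + coordC 2 ^ 2) = 4 * Real.pi := by
    rw [coordC_sum_sq]
    simp [surf_real_univ]
  have e0 := intL_monomial 2 0 0
  have e1 := intL_monomial 0 2 0
  have e2 := intL_monomial 0 0 2
  simp only [pow_zero, mul_one, one_mul] at e0 e1 e2
  rw [map_add, map_add, e0, e1, e2, monoMoment_swap' 0 2 0, monoMoment_swap 2 0 0] at h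
  linarith

/-- Reflecting in the direction `(1, -2, 0)` relates the two independent fourth moments. -/
theorem monoMoment_four_eq : monoMoment 4 0 0 = 3 * monoMoment 2 2 0 := by
  have h := integral_reflect (fun x y z => x ^ 4 * y ^ 0 * z ^ 0) 1 (-2) 0 5 (by norm_num)
  have h2 : intL surf (((81 / 625 : ℝ) • (coordC 0 ^ 4 * coordC 1 ^ 0 * coordC 2 ^ 0) +
      (432 / 625 : ℝ) • (coordC 0 ^ 3 * coordC 1 ^ 1 * coordC 2 ^ 0)) +
      (864 / 625 : ℝ) • (coordC 0 ^ 2 * coordC 1 ^ 2 * coordC 2 ^ 0) +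
      (768 / 625 : ℝ) • (coordC 0 ^ 1 * coordC 1 ^ 3 * coordC 2 ^ 0) +
      (256 / 625 : ℝ) • (coordC 0 ^ 0 * coordC 1 ^ 4 * coordC 2 ^ 0)) = monoMoment 4 0 0 := by
    rw [monoMoment, ← h, intL_apply]
    refine integral_congr_ae (Eventually.of_forall fun p => ?_)
    simp [coordC]
    ring
  simp only [map_add, map_smul, intL_monomial, smul_eq_mul] at h2
  rw [monoMoment_eq_zero_of_odd 3 1 0 (by decide), monoMoment_eq_zero_of_odd 1 3 0 (by decide),
    monoMoment_swap 4 0 0] at h2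
  linarith

theorem monoMoment_two_two : monoMoment 2 2 0 = 4 * Real.pi / 15 := by
  have h : coordC 0 ^ 2 * coordC 1 ^ 0 * coordC 2 ^ 0 =
      coordC 0 ^ 4 * coordC 1 ^ 0 * coordC 2 ^ 0 + coordC 0 ^ 2 * coordC 1 ^ 2 * coordC 2 ^ 0 +
      coordC 0 ^ 2 * coordC 1 ^ 0 * coordC 2 ^ 2 := by
    linear_combination (-coordC 0 ^ 2) * coordC_sum_sq
  have h2 := congrArg (intL surf) h
  simp only [map_add, intL_monomial] at h2
  rw [monoMoment_two, monoMoment_four_eq, monoMoment_swap' 2 2 0] at h2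
  linarith

theorem integral_quad (A : SymZ) : ∫ p, quad A p ∂surf = 0 := by
  have h : quadL A = A.1 0 0 • (coordC 0 ^ 2 * coordC 1 ^ 0 * coordC 2 ^ 0) +
      A.1 1 1 • (coordC 0 ^ 0 * coordC 1 ^ 2 * coordC 2 ^ 0) +
      A.1 2 2 • (coordC 0 ^ 0 * coordC 1 ^ 0 * coordC 2 ^ 2) +
      (2 * A.1 0 1) • (coordC 0 ^ 1 * coordC 1 ^ 1 * coordC 2 ^ 0) +
      (2 * A.1 0 2) • (coordC 0 ^ 1 * coordC 1 ^ 0 * coordC 2 ^ 1) +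
      (2 * A.1 1 2) • (coordC 0 ^ 0 * coordC 1 ^ 1 * coordC 2 ^ 1) := by
    ext p
    simp [quad, coordC, Fin.sum_univ_three, A.symm_apply 1 0, A.symm_apply 2 0, A.symm_apply 2 1]
    ring
  have h2 := congrArg (intL surf) h
  simp only [map_add, map_smul, intL_monomial, smul_eq_mul] at h2
  rw [monoMoment_eq_zero_of_odd 1 1 0 (by decide), monoMoment_eq_zero_of_odd 1 0 1 (by decide),
    monoMoment_eq_zero_of_odd 0 1 1 (by decide), monoMoment_swap' 0 2 0, monoMoment_swap 2 0 0]
    at h2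
  rw [intL_apply] at h2
  simp only [quadL_apply] at h2
  rw [h2]
  linear_combination monoMoment 2 0 0 * A.trace_eq_zero

theorem integral_quad_mul_quad (A B : SymZ) :
    ∫ p, quad A p * quad B p ∂surf = 8 * Real.pi / 15 * dot A B := by
  have h : quadL A * quadL B =
      (A.1 0 0 * B.1 0 0) • (coordC 0 ^ 4 * coordC 1 ^ 0 * coordC 2 ^ 0) +
      (A.1 1 1 * B.1 1 1) • (coordC 0 ^ 0 * coordC 1 ^ 4 * coordC 2 ^ 0) +
      (A.1 2 2 * B.1 2 2) • (coordC 0 ^ 0 * coordC 1 ^ 0 * coordC 2 ^ 4) +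
      (A.1 0 0 * B.1 1 1 + A.1 1 1 * B.1 0 0 + 4 * A.1 0 1 * B.1 0 1) •
        (coordC 0 ^ 2 * coordC 1 ^ 2 * coordC 2 ^ 0) +
      (A.1 0 0 * B.1 2 2 + A.1 2 2 * B.1 0 0 + 4 * A.1 0 2 * B.1 0 2) •
        (coordC 0 ^ 2 * coordC 1 ^ 0 * coordC 2 ^ 2) +
      (A.1 1 1 * B.1 2 2 + A.1 2 2 * B.1 1 1 + 4 * A.1 1 2 * B.1 1 2) •
        (coordC 0 ^ 0 * coordC 1 ^ 2 * coordC 2 ^ 2) +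
      (2 * A.1 0 0 * B.1 0 1 + 2 * A.1 0 1 * B.1 0 0) •
        (coordC 0 ^ 3 * coordC 1 ^ 1 * coordC 2 ^ 0) +
      (2 * A.1 0 0 * B.1 0 2 + 2 * A.1 0 2 * B.1 0 0) •
        (coordC 0 ^ 3 * coordC 1 ^ 0 * coordC 2 ^ 1) +
      (2 * A.1 1 1 * B.1 0 1 + 2 * A.1 0 1 * B.1 1 1) •
        (coordC 0 ^ 1 * coordC 1 ^ 3 * coordC 2 ^ 0) +
      (2 * A.1 1 1 * B.1 1 2 + 2 * A.1 1 2 * B.1 1 1) •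
        (coordC 0 ^ 0 * coordC 1 ^ 3 * coordC 2 ^ 1) +
      (2 * A.1 2 2 * B.1 0 2 + 2 * A.1 0 2 * B.1 2 2) •
        (coordC 0 ^ 1 * coordC 1 ^ 0 * coordC 2 ^ 3) +
      (2 * A.1 2 2 * B.1 1 2 + 2 * A.1 1 2 * B.1 2 2) •
        (coordC 0 ^ 0 * coordC 1 ^ 1 * coordC 2 ^ 3) +
      (2 * A.1 0 0 * B.1 1 2 + 2 * A.1 1 2 * B.1 0 0 + 4 * A.1 0 1 * B.1 0 2 +
        4 * A.1 0 2 * B.1 0 1) • (coordC 0 ^ 2 * coordC 1 ^ 1 * coordC 2 ^ 1) +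
      (2 * A.1 1 1 * B.1 0 2 + 2 * A.1 0 2 * B.1 1 1 + 4 * A.1 0 1 * B.1 1 2 +
        4 * A.1 1 2 * B.1 0 1) • (coordC 0 ^ 1 * coordC 1 ^ 2 * coordC 2 ^ 1) +
      (2 * A.1 2 2 * B.1 0 1 + 2 * A.1 0 1 * B.1 2 2 + 4 * A.1 0 2 * B.1 1 2 +
        4 * A.1 1 2 * B.1 0 2) • (coordC 0 ^ 1 * coordC 1 ^ 1 * coordC 2 ^ 2) := by
    ext p
    simp [quad, coordC, Fin.sum_univ_three, A.symm_apply 1 0, A.symm_apply 2 0, A.symm_apply 2 1,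
      B.symm_apply 1 0, B.symm_apply 2 0, B.symm_apply 2 1]
    ring
  have h2 := congrArg (intL surf) h
  simp only [map_add, map_smul, intL_monomial, smul_eq_mul] at h2
  rw [monoMoment_eq_zero_of_odd 3 1 0 (by decide), monoMoment_eq_zero_of_odd 3 0 1 (by decide),
    monoMoment_eq_zero_of_odd 1 3 0 (by decide), monoMoment_eq_zero_of_odd 0 3 1 (by decide),
    monoMoment_eq_zero_of_odd 1 0 3 (by decide), monoMoment_eq_zero_of_odd 0 1 3 (by decide),
    monoMoment_eq_zero_of_odd 2 1 1 (by decide), monoMoment_eq_zero_of_odd 1 2 1 (by decide),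
    monoMoment_eq_zero_of_odd 1 1 2 (by decide), monoMoment_swap' 0 4 0, monoMoment_swap 4 0 0,
    monoMoment_swap 2 0 2, monoMoment_swap' 2 2 0, monoMoment_four_eq, monoMoment_two_two] at h2
  rw [intL_apply] at h2
  simp only [ContinuousMap.mul_apply, quadL_apply] at h2
  rw [h2]
  simp only [dot, Fin.sum_univ_three, A.symm_apply 1 0, A.symm_apply 2 0, A.symm_apply 2 1,
    B.symm_apply 1 0, B.symm_apply 2 0, B.symm_apply 2 1]
  linear_combination (4 * Real.pi / 15) * (B.1 0 0 + B.1 1 1 + B.1 2 2) * A.trace_eq_zero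

/-! ### The partition function and its derivatives -/

/-- The Boltzmann factor `exp (Λ p · p)`, as the exponential in the Banach algebra of continuous
functions on the sphere. -/
def expC (Λ : SymZ) : C(S2, ℝ) := NormedSpace.exp (quadL Λ)

theorem expC_apply (Λ : SymZ) (p : S2) : expC Λ p = Real.exp (quad Λ p) := by
  have h := NormedSpace.map_exp (f := ContinuousMap.evalAlgHom ℝ ℝ p)
    (continuous_eval_const p) (quadL Λ)
  rw [← Real.exp_eq_exp_ℝ] at h
  exact h

theorem hasStrictFDerivAt_expC (Λ : SymZ) :
    HasStrictFDerivAt expC ((ContinuousLinearMap.mul ℝ C(S2, ℝ) (expC Λ)).comp quadL) Λ := by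
  have h := (hasStrictFDerivAt_exp (𝕂 := ℝ) (x := quadL Λ)).comp Λ quadL.hasStrictFDerivAt
  convert! h using 1

theorem contDiff_expC {n : WithTop ℕ∞} : ContDiff ℝ n expC := by
  have h : AnalyticOnNhd ℝ (NormedSpace.exp : C(S2, ℝ) → C(S2, ℝ)) Set.univ :=
    fun x _ => NormedSpace.exp_analytic x
  have h2 : ContDiff ℝ n (NormedSpace.exp : C(S2, ℝ) → C(S2, ℝ)) := h.contDiff
  exact h2.comp quadL.contDiff

/-- The weight `max (Q p · p - η, 0)`. -/
def wC (η : ℝ) (Q : SymZ) : C(S2, ℝ) :=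
  ⟨fun p => max (quad Q p - η) 0, ((continuous_quad Q).sub continuous_const).max continuous_const⟩

theorem wC_apply (η : ℝ) (Q : SymZ) (p : S2) : wC η Q p = max (quad Q p - η) 0 := rfl

theorem wC_nonneg (η : ℝ) (Q : SymZ) (p : S2) : 0 ≤ wC η Q p := le_max_right _ _

theorem wC_pos_iff {η : ℝ} {Q : SymZ} {p : S2} : 0 < wC η Q p ↔ η < quad Q p := by
  simp [wC_apply]

theorem abs_wC_sub_le (η : ℝ) (Q Q' : SymZ) (p : S2) : |wC η Q p - wC η Q' p| ≤ ‖Q - Q'‖ := by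
  have h := abs_quad_le (Q - Q') p
  rw [quad_sub] at h
  refine (abs_max_sub_max_le_abs _ _ _).trans ?_
  rwa [show quad Q p - η - (quad Q' p - η) = quad Q p - quad Q' p by ring]

theorem continuous_wC (η : ℝ) : Continuous (wC η) := by
  refine (LipschitzWith.of_dist_le_mul (K := 1) fun Q Q' => ?_).continuous
  rw [NNReal.coe_one, one_mul, dist_eq_norm, dist_eq_norm, ContinuousMap.norm_le _ (norm_nonneg _)]
  exact abs_wC_sub_le η Q Q'

/-- Integration against the weight `max (Q p · p - η, 0)`. -/
def wInt (η : ℝ) (Q : SymZ) : C(S2, ℝ) →L[ℝ] ℝ :=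
  (intL surf).comp (ContinuousLinearMap.mul ℝ C(S2, ℝ) (wC η Q))

theorem wInt_apply (η : ℝ) (Q : SymZ) (g : C(S2, ℝ)) :
    wInt η Q g = ∫ p, wC η Q p * g p ∂surf := rfl

/-- The derivative of `wInt η` at `Q` (unless `Q = 0` and `η = 0`): integration of a function times
`A p · p` over `{η < Q p · p}`. -/
def wIntD (η : ℝ) (Q : SymZ) : SymZ →L[ℝ] C(S2, ℝ) →L[ℝ] ℝ :=
  (ContinuousLinearMap.compL ℝ C(S2, ℝ) C(S2, ℝ) ℝ (intL (surf.restrict {p | η < quad Q p}))).comp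
    ((ContinuousLinearMap.mul ℝ C(S2, ℝ)).comp quadL)

theorem measurableSet_lt_quad (η : ℝ) (Q : SymZ) : MeasurableSet {p | η < quad Q p} :=
  (isOpen_lt continuous_const (continuous_quad Q)).measurableSet

theorem wIntD_apply (η : ℝ) (Q A : SymZ) (g : C(S2, ℝ)) :
    wIntD η Q A g = ∫ p in {p | η < quad Q p}, quad A p * g p ∂surf := rfl

/-- Although the weight has a kink where `Q p · p = η`, integration against it is strictly
differentiable in `Q`, as the kink is a null set. -/
theorem hasStrictFDerivAt_wInt {η : ℝ} {Q : SymZ} (h : Q ≠ 0 ∨ η ≠ 0) :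
    HasStrictFDerivAt (wInt η) (wIntD η Q) Q := by
  let S : ℕ → Set S2 := fun n => {p | |quad Q p - η| ≤ 1 / ((n : ℝ) + 1)}
  have hSm : ∀ n, MeasurableSet (S n) := fun n =>
    (isClosed_le (((continuous_quad Q).sub continuous_const).abs) continuous_const).measurableSet
  have hS : Tendsto (fun n => surf.real (S n)) atTop (𝓝 0) := by
    have h1 := tendsto_measure_iInter_atTop (μ := surf) (s := S)
      (fun n => (hSm n).nullMeasurableSet) ?_ ⟨0, measure_ne_top _ _⟩
    · have h2 : ⋂ n, S n = {p | quad Q p = η} := by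
        ext p
        simp only [Set.mem_iInter, Set.mem_ofPred_eq, S]
        constructor
        · intro hp
          have := ge_of_tendsto' (tendsto_one_div_add_atTop_nhds_zero_nat (𝕜 := ℝ)) hp
          exact sub_eq_zero.1 (abs_nonpos_iff.1 this)
        · intro hp n
          rw [hp, sub_self, abs_zero]
          positivity
      rw [h2, surf_quad_eq_null Q η h] at h1
      have h3 := (ENNReal.tendsto_toReal ENNReal.zero_ne_top).comp h1
      rwa [ENNReal.toReal_zero] at h3
    · intro m n hmn p hp
      exact le_trans (α := ℝ) hp (one_div_le_one_div_of_le (by positivity) (by gcongr))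
  refine (hasStrictFDerivAt_iff_isLittleO (𝕜 := ℝ) (f := wInt η) (f' := wIntD η Q) (x := Q)).2
    (Asymptotics.isLittleO_iff.2 fun c hc => ?_)
  obtain ⟨n, hn⟩ := (hS.eventually (gt_mem_nhds (show (0 : ℝ) < c / 2 by positivity))).exists
  have hδ : (0 : ℝ) < 1 / ((n : ℝ) + 1) := by positivity
  have hnh : ∀ᶠ x : SymZ × SymZ in 𝓝 (Q, Q), x ∈ Metric.ball Q (1 / ((n : ℝ) + 1)) ×ˢ
      Metric.ball Q (1 / ((n : ℝ) + 1)) :=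
    prod_mem_nhds (Metric.ball_mem_nhds _ hδ) (Metric.ball_mem_nhds _ hδ)
  filter_upwards [hnh] with x hx
  obtain ⟨hx1, hx2⟩ := hx
  rw [Metric.mem_ball, dist_eq_norm] at hx1 hx2
  refine ContinuousLinearMap.opNorm_le_bound _ (by positivity) fun g => ?_
  let U : Set S2 := {p | η < quad Q p}
  have hU : MeasurableSet U := measurableSet_lt_quad η Q
  have hpt : ∀ p, ‖wC η x.1 p * g p - wC η x.2 p * g p -
      U.indicator (fun p => quad (x.1 - x.2) p * g p) p‖
      ≤ (S n).indicator (fun _ => 2 * ‖x.1 - x.2‖ * ‖g‖) p := by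
    intro p
    have e : U.indicator (fun p => quad (x.1 - x.2) p * g p) p =
        U.indicator (fun p => quad (x.1 - x.2) p) p * g p := by
      by_cases hp : p ∈ U <;> simp [hp]
    rw [e, ← sub_mul, ← sub_mul, norm_mul, Real.norm_eq_abs]
    by_cases hp : p ∈ S n
    · rw [Set.indicator_of_mem hp]
      refine mul_le_mul ?_ (g.norm_coe_le_norm p) (norm_nonneg _) (by positivity)
      refine (abs_sub _ _).trans ?_
      have h1 := abs_wC_sub_le η x.1 x.2 p
      have h2 : |U.indicator (fun p => quad (x.1 - x.2) p) p| ≤ ‖x.1 - x.2‖ := by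
        by_cases hp : p ∈ U
        · simpa [hp] using abs_quad_le _ p
        · simp [hp]
      linarith
    · rw [Set.indicator_of_notMem hp]
      have hp' : 1 / ((n : ℝ) + 1) < |quad Q p - η| := not_le.1 hp
      have h1 := (abs_quad_le (x.1 - Q) p).trans_lt hx1
      have h2 := (abs_quad_le (x.2 - Q) p).trans_lt hx2
      rw [quad_sub, abs_lt] at h1 h2
      have h0 : wC η x.1 p - wC η x.2 p - U.indicator (fun p => quad (x.1 - x.2) p) p = 0 := by
        rcases lt_abs.1 hp' with h3 | h3
        · have hpU : p ∈ U := by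
            change η < quad Q p
            linarith
          rw [Set.indicator_of_mem hpU, wC_apply, wC_apply, max_eq_left, max_eq_left, quad_sub]
          · ring
          · linarith
          · linarith
        · have hpU : p ∉ U := by
            change ¬ η < quad Q p
            linarith
          rw [Set.indicator_of_notMem hpU, wC_apply, wC_apply, max_eq_right, max_eq_right]
          · ring
          · linarith
          · linarith
      rw [h0, abs_zero, zero_mul]
  have hi : ∀ Q', Integrable (fun p => wC η Q' p * g p) surf := fun Q' =>
    integrable_continuousMap surf (wC η Q' * g)
  have hi2 : Integrable (U.indicator (fun p => quad (x.1 - x.2) p * g p)) surf :=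
    (integrable_continuousMap surf (quadL (x.1 - x.2) * g)).indicator hU
  have heq : (wInt η x.1 - wInt η x.2 - wIntD η Q (x.1 - x.2)) g =
      ∫ p, (wC η x.1 p * g p - wC η x.2 p * g p -
        U.indicator (fun p => quad (x.1 - x.2) p * g p) p) ∂surf := by
    refine Eq.trans ?_ (integral_sub ((hi x.1).sub (hi x.2)) hi2).symm
    rw [integral_indicator hU]
    exact congrArg₂ (· - ·) (integral_sub (hi x.1) (hi x.2)).symm rfl
  rw [heq]
  refine (norm_integral_le_of_norm_le ((integrable_const _).indicator (hSm n))
    (Eventually.of_forall hpt)).trans ?_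
  rw [integral_indicator (hSm n), setIntegral_const, smul_eq_mul]
  have := mul_le_mul_of_nonneg_right hn.le (show 0 ≤ 2 * ‖x.1 - x.2‖ * ‖g‖ by positivity)
  linarith

/-- For `η < 0`, the weight is affine in `Q` near `Q = 0`. -/
theorem wInt_eventuallyEq {η : ℝ} (hη : η < 0) :
    wInt η =ᶠ[𝓝 0] fun Q => (intL surf).comp (ContinuousLinearMap.mul ℝ C(S2, ℝ) (quadL Q))
      - η • intL surf := by
  filter_upwards [Metric.ball_mem_nhds (0 : SymZ) (neg_pos.2 hη)] with Q hQ
  rw [Metric.mem_ball, dist_zero_right] at hQ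
  ext g
  have : wC η Q = quadL Q - η • 1 := by
    ext p
    have := abs_lt.1 ((abs_quad_le Q p).trans_lt hQ)
    rw [wC_apply, max_eq_left (by linarith)]
    simp
  simp only [wInt, this, ContinuousLinearMap.comp_apply, ContinuousLinearMap.mul_apply', map_sub, sub_apply, smul_apply]
  simp

theorem contDiffAt_wInt {η : ℝ} (hη : η < 0) {n : WithTop ℕ∞} : ContDiffAt ℝ n (wInt η) 0 := by
  refine ContDiffAt.congr_of_eventuallyEq ?_ (wInt_eventuallyEq hη)
  have h : ContDiff ℝ n (((ContinuousLinearMap.compL ℝ C(S2, ℝ) C(S2, ℝ) ℝ (intL surf)).comp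
    ((ContinuousLinearMap.mul ℝ C(S2, ℝ)).comp quadL))) := ContinuousLinearMap.contDiff _
  exact (h.sub contDiff_const).contDiffAt

/-- The partition function `∫ exp (Λ p · p) max (Q p · p - η, 0) dp`. -/
def partZ (η : ℝ) (x : SymZ × SymZ) : ℝ := wInt η x.1 (expC x.2)

theorem partZ_eq (η : ℝ) (x : SymZ × SymZ) :
    partZ η x = ∫ p, Real.exp (quad x.2 p) * max (quad x.1 p - η) 0 ∂surf := by
  simp only [partZ, wInt_apply, expC_apply, wC_apply, mul_comm]

theorem continuous_wInt (η : ℝ) : Continuous (wInt η) :=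
  continuous_const.clm_comp ((ContinuousLinearMap.mul ℝ C(S2, ℝ)).continuous.comp (continuous_wC η))

theorem continuous_partZ (η : ℝ) : Continuous (partZ η) :=
  ((continuous_wInt η).comp continuous_fst).clm_apply
    ((contDiff_expC (n := 0)).continuous.comp continuous_snd)

/-- The continuous function `M p · p - Q · M`, as a function of `M`. -/
def centered (Q : SymZ) : SymZ →L[ℝ] C(S2, ℝ) :=
  quadL - (ContinuousLinearMap.smulRightL ℝ SymZ C(S2, ℝ) (dotL Q)) 1

@[simp] theorem centered_apply (Q M : SymZ) (p : S2) : centered Q M p = quad M p - dot Q M := by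
  simp [centered]

/-- The stationarity defect `M ↦ ∫ exp (Λ p · p) max (Q p · p - η, 0) (M p · p - Q · M) dp`. It
vanishes if and only if the Gibbs density of `(Q, Λ)` has Q-tensor `Q`. -/
def defect (η : ℝ) (x : SymZ × SymZ) : SymZ →L[ℝ] ℝ :=
  (wInt η x.1).comp ((ContinuousLinearMap.mul ℝ C(S2, ℝ) (expC x.2)).comp (centered x.1))

theorem defect_apply (η : ℝ) (x : SymZ × SymZ) (M : SymZ) :
    defect η x M = wInt η x.1 (expC x.2 * centered x.1 M) := rfl

theorem contDiff_centered {n : WithTop ℕ∞} : ContDiff ℝ n centered := by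
  have h : ContDiff ℝ n fun Q =>
    ((ContinuousLinearMap.smulRightL ℝ SymZ C(S2, ℝ)).flip (1 : C(S2, ℝ))).comp dotL Q :=
    ContinuousLinearMap.contDiff _
  exact contDiff_const.sub h

theorem contDiffAt_defect {η : ℝ} (hη : η < 0) {n : WithTop ℕ∞} (Λ : SymZ) :
    ContDiffAt ℝ n (defect η) (0, Λ) := by
  have h1 : ContDiffAt ℝ n (fun x : SymZ × SymZ => wInt η x.1) (0, Λ) :=
    ContDiffAt.comp (0, Λ) (f := Prod.fst) (contDiffAt_wInt hη) contDiffAt_fst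
  have h2 : ContDiff ℝ n (fun x : SymZ × SymZ => ContinuousLinearMap.mul ℝ C(S2, ℝ) (expC x.2)) :=
    (ContinuousLinearMap.contDiff _).comp (contDiff_expC.comp contDiff_snd)
  exact h1.clm_comp (h2.contDiffAt.clm_comp (contDiff_centered.comp contDiff_fst).contDiffAt)

/-- The defect is strictly differentiable, and its derivative in `Λ` is the (unnormalised)
covariance form. -/
theorem exists_hasStrictFDerivAt_defect {η : ℝ} {Q : SymZ} (h : Q ≠ 0 ∨ η ≠ 0) (Λ : SymZ) :
    ∃ N' : SymZ × SymZ →L[ℝ] SymZ →L[ℝ] ℝ, HasStrictFDerivAt (defect η) N' (Q, Λ) ∧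
      (∀ A, N' (A, 0) = (wIntD η Q A).comp
          ((ContinuousLinearMap.mul ℝ C(S2, ℝ) (expC Λ)).comp (centered Q)) -
          (wInt η Q (expC Λ)) • dotL A) ∧
      ∀ M M', N' (0, M) M' = wInt η Q (expC Λ * quadL M * centered Q M') := by
  have hf := hasStrictFDerivAt_fst (𝕜 := ℝ) (E := SymZ) (F := SymZ) (p := (Q, Λ))
  have hs := hasStrictFDerivAt_snd (𝕜 := ℝ) (E := SymZ) (F := SymZ) (p := (Q, Λ))
  have h1 : HasStrictFDerivAt (fun x : SymZ × SymZ => wInt η x.1)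
      ((wIntD η Q).comp (ContinuousLinearMap.fst ℝ SymZ SymZ)) (Q, Λ) :=
    HasStrictFDerivAt.comp (Q, Λ) (g := wInt η) (hasStrictFDerivAt_wInt h) hf
  have he : HasStrictFDerivAt (fun x : SymZ × SymZ => expC x.2)
      (((ContinuousLinearMap.mul ℝ C(S2, ℝ) (expC Λ)).comp quadL).comp
        (ContinuousLinearMap.snd ℝ SymZ SymZ)) (Q, Λ) :=
    HasStrictFDerivAt.comp (Q, Λ) (hasStrictFDerivAt_expC Λ) hs
  have hm : HasStrictFDerivAt (fun g : C(S2, ℝ) => ContinuousLinearMap.mul ℝ C(S2, ℝ) g)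
      (ContinuousLinearMap.mul ℝ C(S2, ℝ)) (expC Λ) := ContinuousLinearMap.hasStrictFDerivAt _
  have h2 : HasStrictFDerivAt (fun x : SymZ × SymZ => ContinuousLinearMap.mul ℝ C(S2, ℝ) (expC x.2))
      ((ContinuousLinearMap.mul ℝ C(S2, ℝ)).comp
        (((ContinuousLinearMap.mul ℝ C(S2, ℝ) (expC Λ)).comp quadL).comp
        (ContinuousLinearMap.snd ℝ SymZ SymZ))) (Q, Λ) :=
    HasStrictFDerivAt.comp (Q, Λ) (g := fun g => ContinuousLinearMap.mul ℝ C(S2, ℝ) g) hm he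
  have h3 : HasStrictFDerivAt (fun x : SymZ × SymZ => centered x.1)
      (-((((ContinuousLinearMap.smulRightL ℝ SymZ C(S2, ℝ)).flip (1 : C(S2, ℝ))).comp dotL).comp
        (ContinuousLinearMap.fst ℝ SymZ SymZ))) (Q, Λ) :=
    HasStrictFDerivAt.const_sub (ContinuousLinearMap.hasStrictFDerivAt
      ((((ContinuousLinearMap.smulRightL ℝ SymZ C(S2, ℝ)).flip (1 : C(S2, ℝ))).comp dotL).comp
        (ContinuousLinearMap.fst ℝ SymZ SymZ))) quadL
  refine ⟨_, h1.clm_comp (h2.clm_comp h3), fun A => ?_, fun M M' => ?_⟩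
  · ext M
    simp
    ring
  · simp

theorem hasStrictFDerivAt_partZ {η : ℝ} {Q : SymZ} (h : Q ≠ 0 ∨ η ≠ 0) (Λ : SymZ) :
    HasStrictFDerivAt (partZ η)
      (((wIntD η Q).flip (expC Λ)).comp (ContinuousLinearMap.fst ℝ SymZ SymZ) +
        ((wInt η Q).comp ((ContinuousLinearMap.mul ℝ C(S2, ℝ) (expC Λ)).comp quadL)).comp
          (ContinuousLinearMap.snd ℝ SymZ SymZ)) (Q, Λ) := by
  have hf := hasStrictFDerivAt_fst (𝕜 := ℝ) (E := SymZ) (F := SymZ) (p := (Q, Λ))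
  have hs := hasStrictFDerivAt_snd (𝕜 := ℝ) (E := SymZ) (F := SymZ) (p := (Q, Λ))
  have h1 : HasStrictFDerivAt (fun x : SymZ × SymZ => wInt η x.1)
      ((wIntD η Q).comp (ContinuousLinearMap.fst ℝ SymZ SymZ)) (Q, Λ) :=
    HasStrictFDerivAt.comp (Q, Λ) (g := wInt η) (hasStrictFDerivAt_wInt h) hf
  have he : HasStrictFDerivAt (fun x : SymZ × SymZ => expC x.2)
      (((ContinuousLinearMap.mul ℝ C(S2, ℝ) (expC Λ)).comp quadL).comp
        (ContinuousLinearMap.snd ℝ SymZ SymZ)) (Q, Λ) :=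
    HasStrictFDerivAt.comp (Q, Λ) (hasStrictFDerivAt_expC Λ) hs
  refine HasStrictFDerivAt.congr_fderiv (h1.clm_apply he) ?_
  ext A <;> simp

theorem contDiffAt_partZ {η : ℝ} (hη : η < 0) {n : WithTop ℕ∞} (Λ : SymZ) :
    ContDiffAt ℝ n (partZ η) (0, Λ) := by
  have h1 : ContDiffAt ℝ n (fun x : SymZ × SymZ => wInt η x.1) (0, Λ) :=
    ContDiffAt.comp (0, Λ) (f := Prod.fst) (contDiffAt_wInt hη) contDiffAt_fst
  exact h1.clm_apply (contDiff_expC.comp contDiff_snd).contDiffAt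

/-! ### Dual pairs -/

/-- If a weight that is not negligible is integrated against the square of `c + M p · p` to zero,
then `M` and `c` vanish. -/
theorem eq_zero_of_integral_mul_sq {u : S2 → ℝ} (hu : 0 ≤ᵐ[surf] u) (hi : Integrable u surf)
    (hne : ¬ u =ᵐ[surf] 0) {M : SymZ} {c : ℝ}
    (h : ∫ p, u p * (quad M p + c) ^ 2 ∂surf = 0) : M = 0 ∧ c = 0 := by
  by_contra hMc
  have hMc' : M ≠ 0 ∨ -c ≠ 0 := by
    rw [neg_ne_zero]; tauto
  have hnull := surf_quad_eq_null M (-c) hMc'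
  let g : C(S2, ℝ) := (quadL M + c • 1) ^ 2
  have hint : Integrable (fun p => u p * (quad M p + c) ^ 2) surf := by
    have hg : Integrable (fun p => u p * g p) surf :=
      hi.mul_bdd (c := ‖g‖) g.continuous.aestronglyMeasurable (Eventually.of_forall g.norm_coe_le_norm)
    refine hg.congr (Eventually.of_forall fun p => ?_)
    simp [g]
  rw [integral_eq_zero_iff_of_nonneg_ae ?_ hint] at h
  · refine hne ?_
    have hn : ∀ᵐ p ∂surf, quad M p ≠ -c := by
      rw [ae_iff]; simpa using hnull
    filter_upwards [h, hn] with p hp hpn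
    rcases mul_eq_zero.1 hp with h1 | h1
    · exact h1
    · exact absurd (eq_neg_of_add_eq_zero_left (pow_eq_zero_iff two_ne_zero |>.1 h1)) hpn
  · filter_upwards [hu] with p hp
    exact mul_nonneg hp (sq_nonneg _)

/-- `(Q, Λ)` is a dual pair if the Gibbs density `exp (Λ p · p) max (Q p · p - η, 0) / Z` makes
sense and has Q-tensor `Q`. -/
structure IsDual (η : ℝ) (Q Λ : SymZ) : Prop where
  pos : 0 < partZ η (Q, Λ)
  defect_eq_zero : defect η (Q, Λ) = 0

theorem weight_nonneg (η : ℝ) (Q Λ : SymZ) (p : S2) : 0 ≤ wC η Q p * expC Λ p := by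
  rw [expC_apply]
  exact mul_nonneg (wC_nonneg _ _ _) (Real.exp_pos _).le

theorem partZ_pos_iff {η : ℝ} {Q Λ : SymZ} : 0 < partZ η (Q, Λ) ↔ ∃ p, η < quad Q p := by
  have hc : Continuous fun p => wC η Q p * expC Λ p := (wC η Q * expC Λ).continuous
  have h0 : ∀ p, wC η Q p * expC Λ p ≠ 0 ↔ η < quad Q p := by
    intro p
    rw [expC_apply, mul_ne_zero_iff, ← wC_pos_iff]
    simp [(wC_nonneg η Q p).lt_iff_ne', Real.exp_ne_zero]
  have : partZ η (Q, Λ) = ∫ p, wC η Q p * expC Λ p ∂surf := rfl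
  rw [this, integral_pos_iff_support_of_nonneg (weight_nonneg η Q Λ)
    (integrable_continuousMap surf (wC η Q * expC Λ)),
    hc.isOpen_support.measure_pos_iff surf]
  simp only [Set.Nonempty, Function.mem_support, h0]

theorem IsDual.ne_zero_or {η : ℝ} {Q Λ : SymZ} (h : IsDual η Q Λ) : Q ≠ 0 ∨ η ≠ 0 := by
  obtain ⟨p, hp⟩ := partZ_pos_iff.1 h.pos
  by_contra! h0
  rw [h0.1, h0.2, quad_zero] at hp
  exact lt_irrefl _ hp

theorem IsDual.integral_eq {η : ℝ} {Q Λ : SymZ} (h : IsDual η Q Λ) (M : SymZ) :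
    wInt η Q (expC Λ * centered Q M) = 0 := by
  rw [← defect_apply η (Q, Λ), h.defect_eq_zero, zero_apply]

theorem finrank_dual_eq : Module.finrank ℝ SymZ = Module.finrank ℝ (SymZ →L[ℝ] ℝ) := by
  rw [← (LinearMap.toContinuousLinearMap (𝕜 := ℝ) (E := SymZ) (F' := ℝ)).finrank_eq]
  exact (Subspace.dual_finrank_eq (K := ℝ) (V := SymZ)).symm

/-- At a dual pair the derivative of the defect in `Λ` is invertible: it is the covariance form of
the Gibbs density, which is positive definite. -/
theorem IsDual.isInvertible {η : ℝ} {Q Λ : SymZ} (h : IsDual η Q Λ)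
    {N' : SymZ × SymZ →L[ℝ] SymZ →L[ℝ] ℝ}
    (hN : ∀ M M', N' (0, M) M' = wInt η Q (expC Λ * quadL M * centered Q M')) :
    (N'.comp (ContinuousLinearMap.inr ℝ SymZ SymZ)).IsInvertible := by
  let T := N'.comp (ContinuousLinearMap.inr ℝ SymZ SymZ)
  have hinj : Function.Injective (T : SymZ →ₗ[ℝ] SymZ →L[ℝ] ℝ) := by
    rw [← LinearMap.ker_eq_bot, LinearMap.ker_eq_bot']
    intro M hM
    have h1 : N' (0, M) M = 0 := by
      have : T M = 0 := hM
      have h2 : T M M = N' (0, M) M := by simp [T]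
      rw [← h2, this, zero_apply]
    rw [hN] at h1
    have h2 : expC Λ * quadL M * centered Q M =
        expC Λ * centered Q M ^ 2 + dot Q M • (expC Λ * centered Q M) := by
      ext p
      simp
      ring
    rw [h2, map_add, map_smul, h.integral_eq, smul_zero, add_zero, wInt_apply] at h1
    refine (eq_zero_of_integral_mul_sq (u := fun p => wC η Q p * expC Λ p) (c := -dot Q M)
      (Eventually.of_forall (weight_nonneg η Q Λ))
      (integrable_continuousMap surf (wC η Q * expC Λ)) ?_ ?_).1
    · intro h3
      have h4 : partZ η (Q, Λ) = 0 := by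
        change ∫ p, wC η Q p * expC Λ p ∂surf = 0
        rw [integral_congr_ae h3]
        simp
      exact h.pos.ne' h4
    · rw [← h1]
      refine integral_congr_ae (Eventually.of_forall fun p => ?_)
      simp
      ring
  let e := LinearMap.linearEquivOfInjective (T : SymZ →ₗ[ℝ] SymZ →L[ℝ] ℝ) hinj finrank_dual_eq
  refine ⟨e.toContinuousLinearEquiv, ?_⟩
  ext1 M
  rfl

/-- A dual pair extends to a continuous branch of dual pairs, by the implicit function theorem. -/
theorem IsDual.exists_branch {η : ℝ} {Q Λ : SymZ} (h : IsDual η Q Λ) :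
    ∃ L : SymZ → SymZ, Tendsto L (𝓝 Q) (𝓝 Λ) ∧ ∀ᶠ Q' in 𝓝 Q, IsDual η Q' (L Q') := by
  obtain ⟨N', hN', -, hN⟩ := exists_hasStrictFDerivAt_defect h.ne_zero_or Λ
  have hinv := h.isInvertible hN
  have ht := hN'.tendsto_implicitFunctionOfProdDomain hinv
  refine ⟨hN'.implicitFunctionOfProdDomain hinv, ht, ?_⟩
  have hpos : ∀ᶠ x in 𝓝 (Q, Λ), 0 < partZ η x :=
    (continuous_partZ η).continuousAt.eventually (lt_mem_nhds h.pos)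
  filter_upwards [hN'.eventually_apply_implicitFunctionOfProdDomain hinv,
    (Tendsto.prodMk_nhds tendsto_id ht).eventually hpos] with Q' h1 h2
  exact ⟨h2, h1.trans h.defect_eq_zero⟩

/-- For `η < 0` the weight has no kink near `Q = 0`, so that the branch of dual pairs through `(0, 0)`
is smooth. -/
theorem exists_smooth_branch {η : ℝ} (hη : η < 0) (h : IsDual η 0 0) :
    ∃ L : SymZ → SymZ, L 0 = 0 ∧ ContDiffAt ℝ 2 L 0 ∧ ∀ᶠ Q in 𝓝 0, IsDual η Q (L Q) := by
  obtain ⟨N', hN', -, hN⟩ := exists_hasStrictFDerivAt_defect h.ne_zero_or 0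
  have hcd : ContDiffAt ℝ 2 (defect η) (0, 0) := contDiffAt_defect hη 0
  have hinv : (fderiv ℝ (defect η) (0, 0) ∘L .inr ℝ SymZ SymZ).IsInvertible := by
    rw [hN'.hasFDerivAt.fderiv]
    exact h.isInvertible hN
  have hcL := hcd.contDiffAt_implicitFunction two_ne_zero hinv
  have hL0 := hcd.implicitFunction_apply_self two_ne_zero hinv
  refine ⟨hcd.implicitFunction two_ne_zero hinv, hL0, hcL, ?_⟩
  have hpos : ∀ᶠ x in 𝓝 (0, 0), 0 < partZ η x :=
    (continuous_partZ η).continuousAt.eventually (lt_mem_nhds h.pos)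
  have ht : Tendsto (hcd.implicitFunction two_ne_zero hinv) (𝓝 0) (𝓝 0) := by
    have := hcL.continuousAt.tendsto
    rwa [hL0] at this
  filter_upwards [hcd.eventually_apply_implicitFunction two_ne_zero hinv,
    (Tendsto.prodMk_nhds tendsto_id ht).eventually hpos] with Q' h1 h2
  exact ⟨h2, h1.trans h.defect_eq_zero⟩

/-! ### Gibbs densities and the variational principle -/

theorem integrable_density_mul {f : S2 → ℝ} (hf : Integrable f surf) (g : C(S2, ℝ)) :
    Integrable (fun p => f p * g p) surf :=
  hf.mul_bdd (c := ‖g‖) g.continuous.aestronglyMeasurable (Eventually.of_forall g.norm_coe_le_norm)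

theorem integrable_smul_mom {f : S2 → ℝ} (hf : Integrable f surf) :
    Integrable (fun p => f p • mom p) surf :=
  hf.smul_bdd 1 continuous_mom.aestronglyMeasurable (Eventually.of_forall norm_mom_le)

theorem dot_integral_smul_mom {f : S2 → ℝ} (hf : Integrable (fun p => f p • mom p) surf)
    (M : SymZ) : dot (∫ p, f p • mom p ∂surf) M = ∫ p, f p * quad M p ∂surf := by
  have h := (dotL.flip M).integral_comp_comm hf
  simp only [map_smul, ContinuousLinearMap.flip_apply, dotL_apply, dot_mom, smul_eq_mul] at h
  exact h.symm

theorem dot_qTensor {f : S2 → ℝ} (hf : Integrable f surf) (M : SymZ) :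
    dot (qTensor f) M = ∫ p, f p * quad M p ∂surf :=
  dot_integral_smul_mom (integrable_smul_mom hf) M

/-- The integrand `f ln f - f ln (Q p · p - η)` of the energy, with `Q` decoupled from `f`. -/
def entInt (η : ℝ) (Q : SymZ) (f : S2 → ℝ) (p : S2) : ℝ :=
  f p * Real.log (f p) - f p * Real.log (quad Q p - η)

/-- The condition for `∫ f ln f - f ln (Q p · p - η)` to be finite. -/
structure FiniteEntropy (η : ℝ) (Q : SymZ) (f : S2 → ℝ) : Prop where
  lt : ∀ᵐ p ∂surf, 0 < f p → η < quad Q p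
  integrable : Integrable (entInt η Q f) surf

theorem energy_eq {η : ℝ} {f : S2 → ℝ} (h : FiniteEntropy η (qTensor f) f) :
    energy η f = ((∫ p, entInt η (qTensor f) f p ∂surf : ℝ) : EReal) :=
  if_pos ⟨h.lt, h.integrable⟩

theorem energy_lt_top_iff {η : ℝ} {f : S2 → ℝ} :
    energy η f < ⊤ ↔ FiniteEntropy η (qTensor f) f := by
  constructor
  · intro h
    by_contra hn
    have : energy η f = ⊤ := if_neg fun hc => hn ⟨hc.1, hc.2⟩
    exact h.ne this
  · intro h
    rw [energy_eq h]
    exact EReal.coe_lt_top _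

/-- The Gibbs density `exp (Λ p · p) max (Q p · p - η, 0) / Z`. -/
def gibbs (η : ℝ) (Q Λ : SymZ) : C(S2, ℝ) := (partZ η (Q, Λ))⁻¹ • (wC η Q * expC Λ)

theorem gibbs_apply (η : ℝ) (Q Λ : SymZ) (p : S2) :
    gibbs η Q Λ p = 1 / partZ η (Q, Λ) * Real.exp (quad Λ p) * max (quad Q p - η) 0 := by
  simp only [gibbs, ContinuousMap.smul_apply, ContinuousMap.mul_apply, expC_apply, wC_apply,
    smul_eq_mul]
  ring

/-- The dual function `Q · Λ - ln Z(Q, Λ)`, without the thermal term. -/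
def dualG (η : ℝ) (x : SymZ × SymZ) : ℝ := dot x.1 x.2 - Real.log (partZ η x)

theorem dualF_eq (η τ : ℝ) (x : SymZ × SymZ) :
    dualF η τ x = dualG η x - 1 / (2 * τ) * dot x.1 x.1 := by
  rw [dualF, dualG, partZ_eq]; ring

theorem gibbs_nonneg {η : ℝ} {Q Λ : SymZ} (h : 0 < partZ η (Q, Λ)) (p : S2) :
    0 ≤ gibbs η Q Λ p :=
  mul_nonneg (inv_nonneg.2 h.le) (weight_nonneg η Q Λ p)

theorem gibbs_pos_iff {η : ℝ} {Q Λ : SymZ} (h : 0 < partZ η (Q, Λ)) {p : S2} :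
    0 < gibbs η Q Λ p ↔ η < quad Q p := by
  rw [gibbs_apply, mul_pos_iff_of_pos_left (by positivity)]
  exact wC_pos_iff

theorem integral_gibbs {η : ℝ} {Q Λ : SymZ} (h : 0 < partZ η (Q, Λ)) :
    ∫ p, gibbs η Q Λ p ∂surf = 1 := by
  have : intL surf (gibbs η Q Λ) = (partZ η (Q, Λ))⁻¹ * partZ η (Q, Λ) := by
    rw [gibbs, map_smul]; rfl
  rw [inv_mul_cancel₀ h.ne'] at this
  exact this

theorem isDensity_gibbs {η : ℝ} {Q Λ : SymZ} (h : 0 < partZ η (Q, Λ)) :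
    IsDensity (gibbs η Q Λ) :=
  ⟨integrable_continuousMap _ _, Eventually.of_forall (gibbs_nonneg h), integral_gibbs h⟩

theorem IsDual.qTensor_gibbs {η : ℝ} {Q Λ : SymZ} (h : IsDual η Q Λ) :
    qTensor (gibbs η Q Λ) = Q := by
  refine ext_dot fun M => ?_
  rw [dot_qTensor (integrable_continuousMap _ _)]
  have h1 : intL surf (gibbs η Q Λ * quadL M) = (partZ η (Q, Λ))⁻¹ *
      wInt η Q (expC Λ * centered Q M) + dot Q M * intL surf (gibbs η Q Λ) := by
    have : gibbs η Q Λ * quadL M = (partZ η (Q, Λ))⁻¹ • (wC η Q * (expC Λ * centered Q M)) +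
        dot Q M • gibbs η Q Λ := by
      ext p
      simp [gibbs]
      ring
    rw [this, map_add, map_smul, map_smul]
    rfl
  rw [h.integral_eq, intL_apply, intL_apply, integral_gibbs h.pos] at h1
  simpa using h1

theorem entInt_gibbs {η : ℝ} {Q Λ : SymZ} (h : 0 < partZ η (Q, Λ)) (p : S2) :
    entInt η Q (gibbs η Q Λ) p = gibbs η Q Λ p * (quad Λ p - Real.log (partZ η (Q, Λ))) := by
  rcases (gibbs_nonneg h p).eq_or_lt with h0 | h0
  · simp [entInt, ← h0]
  · have hw := (gibbs_pos_iff h).1 h0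
    rw [entInt, ← mul_sub]
    congr 1
    rw [gibbs_apply, max_eq_left (by linarith), Real.log_mul (by positivity) (by linarith),
      Real.log_mul (by positivity) (by positivity), Real.log_exp, one_div, Real.log_inv]
    ring

theorem finiteEntropy_gibbs {η : ℝ} {Q Λ : SymZ} (h : 0 < partZ η (Q, Λ)) :
    FiniteEntropy η Q (gibbs η Q Λ) := by
  refine ⟨Eventually.of_forall fun p hp => (gibbs_pos_iff h).1 hp, ?_⟩
  refine (integrable_continuousMap surf
    (gibbs η Q Λ * (quadL Λ - Real.log (partZ η (Q, Λ)) • 1))).congr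
    (Eventually.of_forall fun p => ?_)
  rw [entInt_gibbs h]
  simp

theorem IsDual.integral_entInt_gibbs {η : ℝ} {Q Λ : SymZ} (h : IsDual η Q Λ) :
    ∫ p, entInt η Q (gibbs η Q Λ) p ∂surf = dualG η (Q, Λ) := by
  have h1 : intL surf (gibbs η Q Λ * quadL Λ - Real.log (partZ η (Q, Λ)) • gibbs η Q Λ) =
      dot Q Λ - Real.log (partZ η (Q, Λ)) := by
    rw [map_sub, map_smul, intL_apply, intL_apply, integral_gibbs h.pos]
    have := dot_qTensor (integrable_continuousMap surf (gibbs η Q Λ)) Λ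
    rw [h.qTensor_gibbs] at this
    simp [this]
  rw [dualG, ← h1, intL_apply]
  refine integral_congr_ae (Eventually.of_forall fun p => ?_)
  simp only [entInt_gibbs h.pos]
  simp
  ring

theorem IsDual.energy_gibbs {η : ℝ} {Q Λ : SymZ} (h : IsDual η Q Λ) :
    energy η (gibbs η Q Λ) = (dualG η (Q, Λ) : ℝ) := by
  have hf := finiteEntropy_gibbs h.pos
  rw [← h.integral_entInt_gibbs]
  have := energy_eq (η := η) (f := gibbs η Q Λ) (by rwa [h.qTensor_gibbs])
  rwa [h.qTensor_gibbs] at this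

/-- The pointwise form of the Gibbs inequality `x ln (x / y) ≥ x - y`, with the equality case. -/
theorem pointwise_gibbs {x w m Z : ℝ} (hx : 0 ≤ x) (hw : 0 < x → 0 < w) (hZ : 0 < Z) :
    0 ≤ x * Real.log x - x * Real.log w - x * (m - Real.log Z) - x +
        1 / Z * Real.exp m * max w 0 ∧
      (x * Real.log x - x * Real.log w - x * (m - Real.log Z) - x +
        1 / Z * Real.exp m * max w 0 = 0 → x = 1 / Z * Real.exp m * max w 0) := by
  rcases hx.eq_or_lt with rfl | hx
  · simp only [zero_mul, sub_zero, zero_add]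
    exact ⟨by positivity, fun h => h.symm⟩
  · have hw := hw hx
    rw [max_eq_left hw.le]
    set y := 1 / Z * Real.exp m * w with hy
    have hy0 : 0 < y := by positivity
    have hlog : Real.log y = m + Real.log w - Real.log Z := by
      rw [hy, Real.log_mul (by positivity) hw.ne', Real.log_mul (by positivity) (by positivity),
        Real.log_exp, one_div, Real.log_inv]
      ring
    have e : x * Real.log x - x * Real.log w - x * (m - Real.log Z) - x + y =
        y * InformationTheory.klFun (x / y) := by
      rw [InformationTheory.klFun_apply, Real.log_div hx.ne' hy0.ne', hlog]
      field_simp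
      ring
    rw [e]
    have hxy : 0 ≤ x / y := by positivity
    refine ⟨mul_nonneg hy0.le (InformationTheory.klFun_nonneg hxy), fun h => ?_⟩
    have := (InformationTheory.klFun_eq_zero_iff hxy).1 ((mul_eq_zero.1 h).resolve_left hy0.ne')
    rwa [div_eq_one_iff_eq hy0.ne'] at this

theorem IsDensity.exists_lt_quad {η : ℝ} {Q : SymZ} {f : S2 → ℝ} (hf : IsDensity f)
    (h : ∀ᵐ p ∂surf, 0 < f p → η < quad Q p) : ∃ p, η < quad Q p := by
  by_contra! hn
  have h0 : f =ᵐ[surf] 0 := by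
    filter_upwards [h, hf.2.1] with p hp hp0
    exact le_antisymm (not_lt.1 fun hlt => absurd (hp hlt) (not_lt.2 (hn p))) hp0
  have := hf.2.2
  rw [integral_congr_ae h0] at this
  simp at this

/-- The Gibbs variational principle: among the densities with Q-tensor `Q` the energy is bounded
below by the dual function, with equality only for the Gibbs density. -/
theorem gibbs_inequality {η : ℝ} {Q : SymZ} {f : S2 → ℝ} (hf : IsDensity f) (hQ : qTensor f = Q)
    (h : FiniteEntropy η Q f) (M : SymZ) :
    dualG η (Q, M) ≤ ∫ p, entInt η Q f p ∂surf ∧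
      (∫ p, entInt η Q f p ∂surf = dualG η (Q, M) → f =ᵐ[surf] gibbs η Q M) := by
  have hZ : 0 < partZ η (Q, M) := partZ_pos_iff.2 (hf.exists_lt_quad h.lt)
  let k : S2 → ℝ := fun p => entInt η Q f p - f p * (quadL M - Real.log (partZ η (Q, M)) • 1) p -
    f p + gibbs η Q M p
  have hk : ∀ᵐ p ∂surf, 0 ≤ k p ∧ (k p = 0 → f p = gibbs η Q M p) := by
    filter_upwards [hf.2.1, h.lt] with p h0 hlt
    have := pointwise_gibbs (m := quad M p) h0 (fun hp => sub_pos.2 (hlt hp)) hZ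
    rw [← gibbs_apply] at this
    simpa [k, entInt] using this
  have i1 := integrable_density_mul hf.1 (quadL M - Real.log (partZ η (Q, M)) • 1)
  have i2 := integrable_continuousMap surf (gibbs η Q M)
  have hki : Integrable k surf := ((h.integrable.sub i1).sub hf.1).add i2
  have hint : ∫ p, k p ∂surf = ∫ p, entInt η Q f p ∂surf - dualG η (Q, M) := by
    have e1 : ∫ p, k p ∂surf = ∫ p, entInt η Q f p ∂surf -
        ∫ p, f p * (quadL M - Real.log (partZ η (Q, M)) • 1) p ∂surf - ∫ p, f p ∂surf +
        ∫ p, gibbs η Q M p ∂surf := by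
      rw [← integral_sub' h.integrable i1, ← integral_sub' (h.integrable.sub i1) hf.1,
        ← integral_add' ((h.integrable.sub i1).sub hf.1) i2]
      rfl
    have e2 : ∫ p, f p * (quadL M - Real.log (partZ η (Q, M)) • 1) p ∂surf = dualG η (Q, M) := by
      have := dot_qTensor hf.1 M
      rw [hQ] at this
      have e3 : (fun p => f p * (quadL M - Real.log (partZ η (Q, M)) • (1 : C(S2, ℝ))) p) =
          fun p => f p * quadL M p - f p * Real.log (partZ η (Q, M)) := by
        funext p
        simp
        ring
      rw [e3, integral_sub (integrable_density_mul hf.1 _) (hf.1.mul_const _), integral_mul_const,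
        hf.2.2, one_mul, dualG, this]
      rfl
    rw [e1, e2, hf.2.2, integral_gibbs hZ]
    ring
  constructor
  · have := integral_nonneg_of_ae (hk.mono fun p hp => hp.1)
    linarith
  · intro heq
    rw [heq, sub_self, integral_eq_zero_iff_of_nonneg_ae (hk.mono fun p hp => hp.1) hki] at hint
    filter_upwards [hint, hk] with p h1 h2
    exact h2.2 h1

theorem IsDual.dualG_le {η : ℝ} {Q Λ : SymZ} (h : IsDual η Q Λ) (M : SymZ) :
    dualG η (Q, M) ≤ dualG η (Q, Λ) := by
  rw [← h.integral_entInt_gibbs]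
  exact (gibbs_inequality (isDensity_gibbs h.pos) h.qTensor_gibbs (finiteEntropy_gibbs h.pos) M).1

theorem IsDual.dualG_le_energy {η : ℝ} {Q Λ : SymZ} (h : IsDual η Q Λ) {f : S2 → ℝ}
    (hf : IsDensity f) (hQ : qTensor f = Q) : (dualG η (Q, Λ) : EReal) ≤ energy η f := by
  by_cases hfe : energy η f < ⊤
  · have hfe' := energy_lt_top_iff.1 hfe
    rw [energy_eq hfe', EReal.coe_le_coe_iff]
    subst hQ
    exact (gibbs_inequality hf rfl hfe' Λ).1
  · rw [not_lt_top_iff.1 hfe]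
    exact le_top

theorem IsDual.J_eq {η : ℝ} {Q Λ : SymZ} (h : IsDual η Q Λ) : J η Q = (dualG η (Q, Λ) : ℝ) := by
  refine le_antisymm ?_ (le_iInf₂ fun f hf => h.dualG_le_energy hf.1 hf.2)
  rw [← h.energy_gibbs]
  exact iInf₂_le _ ⟨isDensity_gibbs h.pos, h.qTensor_gibbs⟩

theorem IsDual.Jreal_eq {η : ℝ} {Q Λ : SymZ} (h : IsDual η Q Λ) :
    Jreal η Q = dualG η (Q, Λ) := by
  rw [Jreal, h.J_eq, EReal.toReal_coe]

theorem IsDual.mem_domJ {η : ℝ} {Q Λ : SymZ} (h : IsDual η Q Λ) : Q ∈ domJ η := by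
  change J η Q < ⊤
  rw [h.J_eq]
  exact EReal.coe_lt_top _

/-! ### Existence of dual pairs -/

/-- The positive part of `M p · p - Q · M`, integrated against the weight. -/
def posInt (η : ℝ) (Q M : SymZ) : ℝ := wInt η Q (centered Q M ⊔ 0)

theorem posInt_pos {η : ℝ} {Q : SymZ} {f : S2 → ℝ} (hf : IsDensity f) (hQ : qTensor f = Q)
    (h : ∀ᵐ p ∂surf, 0 < f p → η < quad Q p) {M : SymZ} (hM : M ≠ 0) : 0 < posInt η Q M := by
  have hnn : ∀ p, 0 ≤ wC η Q p * (centered Q M ⊔ 0) p := fun p =>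
    mul_nonneg (wC_nonneg _ _ _) (by simp)
  have hnn' : 0 ≤ posInt η Q M := integral_nonneg hnn
  refine hnn'.lt_of_ne' fun h0 => hM ?_
  have h1 : (fun p => wC η Q p * (centered Q M ⊔ 0) p) =ᵐ[surf] 0 :=
    (integral_eq_zero_iff_of_nonneg hnn (integrable_continuousMap surf
      (wC η Q * (centered Q M ⊔ 0)))).1 h0
  have h2 : ∀ᵐ p ∂surf, 0 ≤ -(f p * centered Q M p) := by
    filter_upwards [h1, h, hf.2.1] with p hp hlt h0
    rcases (h0 : 0 ≤ f p).eq_or_lt with h0 | h0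
    · simp [← h0]
    · have hw := wC_pos_iff.2 (hlt h0)
      have : (centered Q M ⊔ 0) p = 0 := (mul_eq_zero.1 hp).resolve_left hw.ne'
      have h3 : centered Q M p ≤ 0 := by
        simpa using this
      nlinarith
  have hi := integrable_density_mul hf.1 (centered Q M)
  have h3 : ∫ p, -(f p * centered Q M p) ∂surf = 0 := by
    have e : (fun p => f p * centered Q M p) = fun p => f p * quadL M p - f p * dot Q M := by
      funext p
      simp
      ring
    have := dot_qTensor hf.1 M
    rw [hQ] at this
    rw [integral_neg, e, integral_sub (integrable_density_mul hf.1 _) (hf.1.mul_const _),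
      integral_mul_const, hf.2.2, this]
    simp
  rw [integral_eq_zero_iff_of_nonneg_ae h2 hi.neg] at h3
  refine (eq_zero_of_integral_mul_sq (c := -dot Q M) hf.2.1 hf.1 ?_ ?_).1
  · intro h4
    have := hf.2.2
    rw [integral_congr_ae h4] at this
    simp at this
  · rw [integral_eq_zero_of_ae]
    filter_upwards [h3] with p hp
    have : f p * centered Q M p = 0 := by simpa using hp
    rw [centered_apply] at this
    change f p * (quad M p + -dot Q M) ^ 2 = 0
    linear_combination (quad M p - dot Q M) * this

theorem continuous_posInt (η : ℝ) (Q : SymZ) : Continuous (posInt η Q) := by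
  have hpos : LipschitzWith 1 fun g : C(S2, ℝ) => g ⊔ 0 := by
    refine LipschitzWith.of_dist_le_mul fun g g' => ?_
    rw [NNReal.coe_one, one_mul, ContinuousMap.dist_le dist_nonneg]
    intro p
    refine le_trans ?_ (ContinuousMap.dist_apply_le_dist p)
    exact abs_max_sub_max_le_abs (g p) (g' p) 0
  exact (wInt η Q).continuous.comp (hpos.continuous.comp (centered Q).continuous)

theorem posInt_smul (η : ℝ) (Q M : SymZ) {t : ℝ} (ht : 0 ≤ t) :
    posInt η Q (t • M) = t * posInt η Q M := by
  rw [posInt, posInt, ← smul_eq_mul, ← map_smul]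
  congr 1
  ext p
  simp only [map_smul, ContinuousMap.sup_apply, ContinuousMap.smul_apply, ContinuousMap.zero_apply,
    smul_eq_mul]
  change max _ _ = t * max _ _
  rw [mul_max_of_nonneg _ _ ht, mul_zero]

/-- If `Q` is the Q-tensor of a density supported in `{η < Q p · p}`, there is a dual pair `(Q, Λ)`:
`Λ` minimises the coercive function `∫ exp (Λ p · p - Q · Λ) max (Q p · p - η, 0) dp`. -/
theorem exists_isDual {η : ℝ} {Q : SymZ} {f : S2 → ℝ} (hf : IsDensity f) (hQ : qTensor f = Q)
    (h : ∀ᵐ p ∂surf, 0 < f p → η < quad Q p) : ∃ Λ, IsDual η Q Λ := by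
  obtain ⟨c, hc, hcle⟩ := (isCompact_sphere (0 : SymZ) 1).exists_forall_le'
    (continuous_posInt η Q).continuousOn (a := 0) (fun M hM => posInt_pos hf hQ h (by
      rintro rfl
      simp at hM))
  have hlow : ∀ M, c * ‖M‖ ≤ posInt η Q M := by
    intro M
    by_cases hM : M = 0
    · subst hM
      rw [norm_zero, mul_zero, ← zero_smul ℝ (0 : SymZ), posInt_smul _ _ _ le_rfl, zero_mul]
    · have hn : 0 < ‖M‖ := norm_pos_iff.2 hM
      have h1 := hcle (‖M‖⁻¹ • M) (by
        rw [mem_sphere_zero_iff_norm, norm_smul, norm_inv, norm_norm, inv_mul_cancel₀ hn.ne'])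
      rw [posInt_smul _ _ _ (by positivity)] at h1
      rw [mul_comm]
      calc ‖M‖ * c ≤ ‖M‖ * (‖M‖⁻¹ * posInt η Q M) := by gcongr
        _ = posInt η Q M := by field_simp
  let Ψ : SymZ → ℝ := fun Λ => Real.exp (-dotL Q Λ) * wInt η Q (expC Λ)
  have hΨ : ∀ Λ, posInt η Q Λ ≤ Ψ Λ := by
    intro Λ
    have : Ψ Λ = wInt η Q (Real.exp (-dotL Q Λ) • expC Λ) := by rw [map_smul]; rfl
    rw [this, posInt, wInt_apply, wInt_apply]
    refine integral_mono (integrable_continuousMap surf (wC η Q * (centered Q Λ ⊔ 0)))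
      (integrable_continuousMap surf (wC η Q * (Real.exp (-dotL Q Λ) • expC Λ))) fun p => ?_
    refine mul_le_mul_of_nonneg_left ?_ (wC_nonneg _ _ _)
    simp only [ContinuousMap.sup_apply, ContinuousMap.smul_apply, smul_eq_mul, expC_apply,
      ← Real.exp_add, centered_apply, ContinuousMap.zero_apply]
    refine max_le ?_ (Real.exp_pos _).le
    have := Real.add_one_le_exp (-dotL Q Λ + quad Λ p)
    rw [dotL_apply] at this ⊢
    linarith
  have hcont : Continuous Ψ := (Real.continuous_exp.comp (dotL Q).continuous.neg).mul
    ((wInt η Q).continuous.comp (contDiff_expC (n := 0)).continuous)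
  have hlim : Tendsto Ψ (cocompact SymZ) atTop :=
    tendsto_atTop_mono (fun M => (hlow M).trans (hΨ M))
      (tendsto_norm_cocompact_atTop.const_mul_atTop hc)
  obtain ⟨Λ, hΛ⟩ := hcont.exists_forall_le hlim
  have hd : HasFDerivAt Ψ (Real.exp (-dotL Q Λ) • ((wInt η Q).comp
      ((ContinuousLinearMap.mul ℝ C(S2, ℝ) (expC Λ)).comp quadL)) +
      wInt η Q (expC Λ) • (Real.exp (-dotL Q Λ) • (-dotL Q))) Λ :=
    ((dotL Q).hasFDerivAt.neg.exp).mul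
      ((wInt η Q).hasFDerivAt.comp Λ (hasStrictFDerivAt_expC Λ).hasFDerivAt)
  have h0 := IsLocalMin.hasFDerivAt_eq_zero (Eventually.of_forall hΛ) hd
  refine ⟨Λ, partZ_pos_iff.2 (hf.exists_lt_quad h), ?_⟩
  ext M
  have h1 := DFunLike.congr_fun h0 M
  have h2 : expC Λ * centered Q M = expC Λ * quadL M - dot Q M • expC Λ := by
    ext p
    simp
    ring
  rw [defect_apply, h2, map_sub, map_smul]
  simp only [add_apply, smul_apply, neg_apply, dotL_apply, ContinuousLinearMap.comp_apply,
    ContinuousLinearMap.mul_apply', zero_apply, smul_eq_mul] at h1 ⊢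
  have h3 : Real.exp (-dot Q Λ) * (wInt η Q (expC Λ * quadL M) - dot Q M * wInt η Q (expC Λ)) = 0 := by
    linarith
  exact (mul_eq_zero.1 h3).resolve_left (Real.exp_ne_zero _)

theorem mem_domJ_iff {η : ℝ} {Q : SymZ} : Q ∈ domJ η ↔ ∃ Λ, IsDual η Q Λ := by
  refine ⟨fun h => ?_, fun ⟨Λ, h⟩ => h.mem_domJ⟩
  obtain ⟨f, h⟩ := iInf_lt_iff.1 (show J η Q < ⊤ from h)
  obtain ⟨hf, h⟩ := iInf_lt_iff.1 h
  have := (energy_lt_top_iff.1 h).lt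
  rw [hf.2] at this
  exact exists_isDual hf.1 hf.2 this

theorem isOpen_domJ (η : ℝ) : IsOpen (domJ η) := by
  rw [isOpen_iff_mem_nhds]
  intro Q hQ
  obtain ⟨Λ, h⟩ := mem_domJ_iff.1 hQ
  obtain ⟨L, -, hL⟩ := h.exists_branch
  exact hL.mono fun Q' h' => h'.mem_domJ

/-! ### Local minimisers at fixed Q-tensor are Gibbs densities -/

/-- Integration of continuous functions against an integrable density. -/
def pairL (k : S2 → ℝ) (hk : Integrable k surf) : C(S2, ℝ) →L[ℝ] ℝ :=
  LinearMap.mkContinuous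
    { toFun := fun g => ∫ p, k p * g p ∂surf
      map_add' := fun f g => by
        rw [← integral_add (integrable_density_mul hk f) (integrable_density_mul hk g)]
        simp [mul_add]
      map_smul' := fun c f => by
        rw [RingHom.id_apply, smul_eq_mul, ← integral_const_mul]
        congr 1
        funext p
        simp
        ring }
    (∫ p, ‖k p‖ ∂surf) (fun g => by
      rw [← integral_mul_const]
      refine norm_integral_le_of_norm_le (hk.norm.mul_const _) (Eventually.of_forall fun p => ?_)
      rw [norm_mul]
      exact mul_le_mul_of_nonneg_left (g.norm_coe_le_norm p) (norm_nonneg _))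

theorem norm_pairL_le {k : S2 → ℝ} (hk : Integrable k surf) :
    ‖pairL k hk‖ ≤ ∫ p, ‖k p‖ ∂surf :=
  LinearMap.mkContinuous_norm_le _ (integral_nonneg fun _ => norm_nonneg _) _

/-- The function `M p · p + b`, as a function of `(b, M)`. -/
def affL : ℝ × SymZ →L[ℝ] C(S2, ℝ) :=
  (ContinuousLinearMap.toSpanSingleton ℝ (1 : C(S2, ℝ))).comp (ContinuousLinearMap.fst ℝ ℝ SymZ) +
    quadL.comp (ContinuousLinearMap.snd ℝ ℝ SymZ)

@[simp] theorem affL_apply (v : ℝ × SymZ) (p : S2) : affL v p = quad v.2 p + v.1 := by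
  simp [affL, add_comm]

/-- Mass and Q-tensor of any integrable function `k` are matched by those of `u` times a
function `B p · p + b`, with a bound on `(b, B)` by the `L¹` norm of `k`: the Gram matrix of the
functions `1, p ⊗ p - I / 3` with respect to `u` is invertible. -/
theorem exists_moment_correction {u : S2 → ℝ} (hu : 0 ≤ᵐ[surf] u) (hi : Integrable u surf)
    (hne : ¬ u =ᵐ[surf] 0) :
    ∃ C : ℝ, 0 ≤ C ∧ ∀ k : S2 → ℝ, Integrable k surf → ∃ v : ℝ × SymZ,
      ‖v‖ ≤ C * ∫ p, ‖k p‖ ∂surf ∧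
      ∀ v' : ℝ × SymZ, ∫ p, u p * affL v p * affL v' p ∂surf = ∫ p, k p * affL v' p ∂surf := by
  let T : ℝ × SymZ →ₗ[ℝ] (ℝ × SymZ →L[ℝ] ℝ) :=
    { toFun := fun v => (pairL u hi).comp ((ContinuousLinearMap.mul ℝ C(S2, ℝ) (affL v)).comp affL)
      map_add' := fun v w => by
        refine ContinuousLinearMap.ext fun v' => ?_
        simp
      map_smul' := fun c v => by
        refine ContinuousLinearMap.ext fun v' => ?_
        simp }
  have hT : ∀ v v', T v v' = ∫ p, u p * affL v p * affL v' p ∂surf := by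
    intro v v'
    change ∫ p, u p * (affL v p * affL v' p) ∂surf = _
    simp only [mul_assoc]
  have hinj : Function.Injective T := by
    rw [← LinearMap.ker_eq_bot, LinearMap.ker_eq_bot']
    intro v hv
    have h1 := hT v v
    rw [hv, zero_apply] at h1
    have h2 := eq_zero_of_integral_mul_sq hu hi hne (M := v.2) (c := v.1) (by
      rw [h1]
      refine integral_congr_ae (Eventually.of_forall fun p => ?_)
      simp
      ring)
    exact Prod.ext h2.2 h2.1
  have hdim : Module.finrank ℝ (ℝ × SymZ) = Module.finrank ℝ (ℝ × SymZ →L[ℝ] ℝ) := by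
    rw [← (LinearMap.toContinuousLinearMap (𝕜 := ℝ) (E := ℝ × SymZ) (F' := ℝ)).finrank_eq]
    exact (Subspace.dual_finrank_eq (K := ℝ) (V := ℝ × SymZ)).symm
  let e := LinearMap.linearEquivOfInjective T hinj hdim
  let s : (ℝ × SymZ →L[ℝ] ℝ) →L[ℝ] ℝ × SymZ :=
    LinearMap.toContinuousLinearMap (e.symm : (ℝ × SymZ →L[ℝ] ℝ) →ₗ[ℝ] ℝ × SymZ)
  refine ⟨‖s‖ * ‖affL‖, by positivity, fun k hk => ⟨s ((pairL k hk).comp affL), ?_, fun v' => ?_⟩⟩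
  · refine (s.le_opNorm _).trans ?_
    rw [mul_assoc]
    refine mul_le_mul_of_nonneg_left ?_ (norm_nonneg _)
    refine (ContinuousLinearMap.opNorm_comp_le _ _).trans ?_
    rw [mul_comm]
    exact mul_le_mul_of_nonneg_left (norm_pairL_le hk) (norm_nonneg _)
  · rw [← hT]
    have : T (s ((pairL k hk).comp affL)) = (pairL k hk).comp affL := e.apply_symm_apply _
    rw [this]
    rfl

theorem entInt_lower_bound {η : ℝ} {Q : SymZ} {f : S2 → ℝ} {p : S2} (h0 : 0 ≤ f p)
    (hlt : 0 < f p → η < quad Q p) : f p - wC η Q p ≤ entInt η Q f p := by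
  have := (pointwise_gibbs (m := 0) h0 (fun hp => sub_pos.2 (hlt hp)) one_pos).1
  rw [Real.log_one, Real.exp_zero] at this
  rw [entInt, wC_apply]
  linarith

theorem aestronglyMeasurable_entInt {η : ℝ} {Q : SymZ} {f : S2 → ℝ} (hf : Integrable f surf) :
    AEStronglyMeasurable (entInt η Q f) surf := by
  have h1 := hf.aestronglyMeasurable.aemeasurable
  have h2 : Measurable fun p => Real.log (quad Q p - η) :=
    Real.measurable_log.comp ((continuous_quad Q).measurable.sub measurable_const)
  exact ((h1.mul h1.log).sub (h1.mul h2.aemeasurable)).aestronglyMeasurable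

/-- The entropy integrand is bounded below by an integrable function, so that it is integrable as
soon as it is bounded above by one. -/
theorem finiteEntropy_of_le {η : ℝ} {Q : SymZ} {f B : S2 → ℝ} (hf : Integrable f surf)
    (h0 : ∀ᵐ p ∂surf, 0 ≤ f p) (hlt : ∀ᵐ p ∂surf, 0 < f p → η < quad Q p)
    (hB : Integrable B surf) (hle : ∀ᵐ p ∂surf, entInt η Q f p ≤ B p) : FiniteEntropy η Q f := by
  refine ⟨hlt, ((hB.norm.add (hf.sub (integrable_continuousMap surf (wC η Q))).norm).mono'
    (aestronglyMeasurable_entInt hf) ?_)⟩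
  filter_upwards [h0, hlt, hle] with p h0 hlt hle
  have h1 := entInt_lower_bound h0 hlt
  simp only [Pi.add_apply, Pi.sub_apply, Real.norm_eq_abs]
  rw [abs_le]
  constructor
  · linarith [neg_abs_le (f p - wC η Q p), abs_nonneg (B p)]
  · linarith [le_abs_self (B p), abs_nonneg (f p - wC η Q p)]

theorem entInt_convex {η : ℝ} {Q : SymZ} {f g : S2 → ℝ} {p : S2} {t : ℝ} (hf : 0 ≤ f p)
    (hg : 0 ≤ g p) (ht0 : 0 ≤ t) (ht1 : t ≤ 1) :
    entInt η Q (fun p => (1 - t) * f p + t * g p) p ≤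
      (1 - t) * entInt η Q f p + t * entInt η Q g p := by
  have := Real.convexOn_mul_log.2 (x := f p) (y := g p) hf hg (sub_nonneg.2 ht1) ht0 (by ring)
  simp only [smul_eq_mul] at this
  simp only [entInt]
  linarith

theorem FiniteEntropy.convex {η : ℝ} {Q : SymZ} {f g : S2 → ℝ} (hf : IsDensity f)
    (hg : IsDensity g) (hfe : FiniteEntropy η Q f) (hge : FiniteEntropy η Q g) {t : ℝ}
    (ht0 : 0 ≤ t) (ht1 : t ≤ 1) :
    FiniteEntropy η Q (fun p => (1 - t) * f p + t * g p) ∧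
      ∫ p, entInt η Q (fun p => (1 - t) * f p + t * g p) p ∂surf ≤
        (1 - t) * ∫ p, entInt η Q f p ∂surf + t * ∫ p, entInt η Q g p ∂surf := by
  have hle : ∀ᵐ p ∂surf, entInt η Q (fun p => (1 - t) * f p + t * g p) p ≤
      (1 - t) * entInt η Q f p + t * entInt η Q g p := by
    filter_upwards [hf.2.1, hg.2.1] with p h1 h2
    exact entInt_convex h1 h2 ht0 ht1
  have hB := (hfe.integrable.const_mul (1 - t)).add (hge.integrable.const_mul t)
  have hfin := finiteEntropy_of_le ((hf.1.const_mul (1 - t)).add (hg.1.const_mul t)) ?_ ?_ hB hle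
  · refine ⟨hfin, ?_⟩
    rw [← integral_const_mul, ← integral_const_mul,
      ← integral_add (hfe.integrable.const_mul (1 - t)) (hge.integrable.const_mul t)]
    exact integral_mono_ae hfin.integrable hB hle
  · filter_upwards [hf.2.1, hg.2.1] with p h1 h2
    exact add_nonneg (mul_nonneg (sub_nonneg.2 ht1) h1) (mul_nonneg ht0 h2)
  · filter_upwards [hf.2.1, hg.2.1, hfe.lt, hge.lt] with p h1 h2 h3 h4 h5
    by_contra hn
    have e1 : f p = 0 := le_antisymm (not_lt.1 fun h => hn (h3 h)) h1
    have e2 : g p = 0 := le_antisymm (not_lt.1 fun h => hn (h4 h)) h2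
    simp [e1, e2] at h5

theorem IsDensity.convex {f g : S2 → ℝ} (hf : IsDensity f) (hg : IsDensity g) {t : ℝ}
    (ht0 : 0 ≤ t) (ht1 : t ≤ 1) : IsDensity (fun p => (1 - t) * f p + t * g p) := by
  refine ⟨(hf.1.const_mul _).add (hg.1.const_mul _), ?_, ?_⟩
  · filter_upwards [hf.2.1, hg.2.1] with p h1 h2
    exact add_nonneg (mul_nonneg (sub_nonneg.2 ht1) h1) (mul_nonneg ht0 h2)
  · rw [integral_add (hf.1.const_mul _) (hg.1.const_mul _), integral_const_mul, integral_const_mul,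
      hf.2.2, hg.2.2]
    ring

theorem qTensor_convex {f g : S2 → ℝ} (hf : Integrable f surf) (hg : Integrable g surf)
    (h : qTensor g = qTensor f) (t : ℝ) :
    qTensor (fun p => (1 - t) * f p + t * g p) = qTensor f := by
  have : qTensor (fun p => (1 - t) * f p + t * g p) = (1 - t) • qTensor f + t • qTensor g := by
    have i1 : Integrable (fun p => (1 - t) • f p • mom p) surf := (integrable_smul_mom hf).fun_smul _
    have i2 : Integrable (fun p => t • g p • mom p) surf := (integrable_smul_mom hg).fun_smul _
    rw [qTensor, qTensor, qTensor, ← integral_smul, ← integral_smul, ← integral_add i1 i2]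
    simp only [add_smul, mul_smul]
  rw [this, h, ← add_smul]
  simp

/-- The energy of a density `f` of finite energy which is not the Gibbs density can be lowered by a
density with the same Q-tensor that differs from `f` by a bounded function. It agrees with the Gibbs
density, slightly corrected, on a large sublevel set of `f`, and with `f` elsewhere. -/
theorem exists_bounded_competitor {η : ℝ} {Q Λ : SymZ} (hd : IsDual η Q Λ) {f : S2 → ℝ}
    (hf : IsDensity f) (hfe : FiniteEntropy η Q f)
    (hlt : dualG η (Q, Λ) < ∫ p, entInt η Q f p ∂surf) :
    ∃ (g : S2 → ℝ) (B : ℝ), IsDensity g ∧ qTensor g = Q ∧ FiniteEntropy η Q g ∧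
      (∀ᵐ p ∂surf, ‖g p - f p‖ ≤ B) ∧
      ∫ p, entInt η Q g p ∂surf < ∫ p, entInt η Q f p ∂surf := by
  let h : C(S2, ℝ) := gibbs η Q Λ
  have hh0 : ∀ p, 0 ≤ h p := gibbs_nonneg hd.pos
  have hhi : Integrable h surf := integrable_continuousMap _ _
  have hhe := finiteEntropy_gibbs hd.pos
  obtain ⟨f', hf'm, hff'⟩ := hf.1.aestronglyMeasurable
  let S : ℕ → Set S2 := fun n => {p | f' p ≤ n}
  have hSm : ∀ n, MeasurableSet (S n) := fun n => hf'm.measurable measurableSet_Iic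
  have hSmem : ∀ p, ∀ᶠ n in atTop, p ∈ S n := by
    intro p
    obtain ⟨N, hN⟩ := exists_nat_ge (f' p)
    filter_upwards [eventually_ge_atTop N] with n hn
    exact hN.trans (Nat.cast_le.2 hn)
  -- the correction is supported in a fixed sublevel set on which `h` is not negligible
  obtain ⟨n₀, hn₀⟩ : ∃ n₀, ¬ (S n₀).indicator h =ᵐ[surf] 0 := by
    by_contra! hall
    have h0 : h =ᵐ[surf] 0 := by
      filter_upwards [ae_all_iff.2 hall] with p hp
      obtain ⟨n, hn⟩ := (hSmem p).exists
      have := hp n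
      rwa [Set.indicator_of_mem hn] at this
    have h1 : ∫ p, h p ∂surf = 1 := integral_gibbs hd.pos
    rw [integral_congr_ae h0] at h1
    simp at h1
  let u : S2 → ℝ := (S n₀).indicator h
  have hu0 : ∀ p, 0 ≤ u p := fun p => Set.indicator_nonneg (fun p _ => hh0 p) p
  have hui : Integrable u surf := hhi.indicator (hSm n₀)
  obtain ⟨C, hC, hcorr⟩ := exists_moment_correction (Eventually.of_forall hu0) hui hn₀
  let k : ℕ → S2 → ℝ := fun n => (S n)ᶜ.indicator fun p => h p - f p
  have hki : ∀ n, Integrable (k n) surf := fun n => (hhi.sub hf.1).indicator (hSm n).compl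
  choose v hv hvm using fun n => hcorr (k n) (hki n)
  have hk0 : Tendsto (fun n => ∫ p, ‖k n p‖ ∂surf) atTop (𝓝 0) := by
    have := tendsto_integral_of_dominated_convergence (μ := surf) (F := fun n p => ‖k n p‖)
      (f := fun _ => 0) (fun p => ‖h p - f p‖) (fun n => (hki n).norm.aestronglyMeasurable)
      (hhi.sub hf.1).norm (fun n => Eventually.of_forall fun p => ?_)
      (Eventually.of_forall fun p => ?_)
    · simpa using this
    · rw [norm_norm]
      exact norm_indicator_le_norm_self _ _
    · refine tendsto_const_nhds.congr' ?_
      filter_upwards [hSmem p] with n hn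
      simp [k, hn]
  have hv0 : Tendsto (fun n => ‖v n‖) atTop (𝓝 0) := by
    refine squeeze_zero (fun n => norm_nonneg _) hv ?_
    simpa using hk0.const_mul C
  let δ : ℕ → ℝ := fun n => ‖affL‖ * ‖v n‖
  have hδ0 : Tendsto δ atTop (𝓝 0) := by simpa using hv0.const_mul ‖affL‖
  have hδ : ∀ n p, |affL (v n) p| ≤ δ n := fun n p =>
    ((affL (v n)).norm_coe_le_norm p).trans (affL.le_opNorm _)
  let g : ℕ → S2 → ℝ := fun n p => (f p + (S n).indicator (fun p => h p - f p) p) +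
    u p * affL (v n) p
  -- the form of the competitor on the sublevel set and outside
  have hgS : ∀ n p, p ∈ S n → ∃ c, |c| ≤ δ n ∧ g n p = h p * (1 + c) := by
    intro n p hp
    refine ⟨(S n₀).indicator (fun p => affL (v n) p) p, ?_, ?_⟩
    · by_cases hp0 : p ∈ S n₀
      · simpa [hp0] using hδ n p
      · simp only [Set.indicator_of_notMem hp0, abs_zero]
        positivity
    · by_cases hp0 : p ∈ S n₀ <;> simp [g, u, hp, hp0] <;> ring
  have hgSc : ∀ n, n₀ ≤ n → ∀ p, p ∉ S n → g n p = f p := by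
    intro n hn p hp
    have hp0 : p ∉ S n₀ := fun h0 => hp (le_trans (α := ℝ) h0 (Nat.cast_le.2 hn))
    simp [g, u, hp, hp0]
  have hki' : ∀ n, Integrable ((S n).indicator fun p => h p - f p) surf := fun n =>
    (hhi.sub hf.1).indicator (hSm n)
  have hua : ∀ n, Integrable (fun p => u p * affL (v n) p) surf := fun n =>
    integrable_density_mul hui _
  have hgi : ∀ n, Integrable (g n) surf := fun n => (hf.1.add (hki' n)).add (hua n)
  have hgmom : ∀ n v', ∫ p, g n p * affL v' p ∂surf = ∫ p, h p * affL v' p ∂surf := by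
    intro n v'
    have e1 : ∀ p, g n p * affL v' p = (h p * affL v' p - k n p * affL v' p) +
        u p * affL (v n) p * affL v' p := by
      intro p
      by_cases hp : p ∈ S n <;> (simp [g, k, hp]; ring)
    have i1 := integrable_density_mul hhi (affL v')
    have i2 := integrable_density_mul (hki n) (affL v')
    have i3 := integrable_density_mul (hua n) (affL v')
    simp only [e1]
    rw [integral_add (f := fun p => h p * affL v' p - k n p * affL v' p) (i1.sub i2) i3,
      integral_sub i1 i2, hvm]
    ring
  have hgmass : ∀ n, ∫ p, g n p ∂surf = 1 := by
    intro n
    have := hgmom n (1, 0)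
    simp only [affL_apply, quad_zero, zero_add, mul_one] at this
    rw [this]
    exact integral_gibbs hd.pos
  have hgQ : ∀ n, qTensor (g n) = Q := by
    intro n
    rw [← hd.qTensor_gibbs]
    refine ext_dot fun M => ?_
    rw [dot_qTensor (hgi n), dot_qTensor (integrable_continuousMap _ _)]
    have := hgmom n (0, M)
    simpa only [affL_apply, add_zero] using this
  -- the upper bound for the entropy of the competitor
  let K : ℝ := 3 / 2 + (‖Λ‖ + |Real.log (partZ η (Q, Λ))|)
  let b : ℕ → S2 → ℝ := fun n p =>
    (S n).indicator (entInt η Q h) p + (S n)ᶜ.indicator (entInt η Q f) p + δ n * (K * h p)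
  have hbi : ∀ n, Integrable (b n) surf := fun n =>
    ((hhe.integrable.indicator (hSm n)).add (hfe.integrable.indicator (hSm n).compl)).add
      ((hhi.const_mul K).const_mul _)
  have hblim : Tendsto (fun n => ∫ p, b n p ∂surf) atTop (𝓝 (dualG η (Q, Λ))) := by
    rw [← hd.integral_entInt_gibbs]
    obtain ⟨D, hD⟩ := hδ0.norm.bddAbove_range
    refine tendsto_integral_of_dominated_convergence
      (fun p => (|entInt η Q h p| + |entInt η Q f p|) + D * (|K| * h p))
      (fun n => (hbi n).aestronglyMeasurable)
      ((hhe.integrable.abs.add hfe.integrable.abs).add ((hhi.const_mul _).const_mul _))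
      (fun n => Eventually.of_forall fun p => ?_) (Eventually.of_forall fun p => ?_)
    · refine (norm_add_le _ _).trans (add_le_add ((norm_add_le _ _).trans (add_le_add ?_ ?_)) ?_)
      · exact norm_indicator_le_norm_self _ _
      · exact norm_indicator_le_norm_self _ _
      · rw [norm_mul (δ n), norm_mul K, Real.norm_eq_abs K, Real.norm_of_nonneg (hh0 p)]
        exact mul_le_mul_of_nonneg_right (hD ⟨n, rfl⟩) (mul_nonneg (abs_nonneg _) (hh0 p))
    · have h1 : Tendsto (fun n => entInt η Q h p + δ n * (K * h p)) atTop
          (𝓝 (entInt η Q h p)) := by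
        simpa using (hδ0.mul_const (K * h p)).const_add (entInt η Q h p)
      refine h1.congr' ?_
      filter_upwards [hSmem p] with n hn
      simp [b, hn]
  have hδsmall : ∀ᶠ n in atTop, δ n < 1 / 2 := hδ0.eventually (gt_mem_nhds (by norm_num))
  obtain ⟨n, ⟨hnlt, hnδ⟩, hnn₀⟩ :=
    (((hblim.eventually (gt_mem_nhds hlt)).and hδsmall).and (eventually_ge_atTop n₀)).exists
  have hg0 : ∀ᵐ p ∂surf, 0 ≤ g n p := by
    filter_upwards [hf.2.1] with p hp
    by_cases hpS : p ∈ S n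
    · obtain ⟨c, hc, hgc⟩ := hgS n p hpS
      rw [hgc]
      exact mul_nonneg (hh0 p) (by linarith [(abs_le.1 hc).1])
    · rwa [hgSc n hnn₀ p hpS]
  have hglt : ∀ᵐ p ∂surf, 0 < g n p → η < quad Q p := by
    filter_upwards [hfe.lt] with p hp hgp
    by_cases hpS : p ∈ S n
    · obtain ⟨c, hc, hgc⟩ := hgS n p hpS
      rw [hgc] at hgp
      refine (gibbs_pos_iff hd.pos).1 ((hh0 p).lt_of_ne' fun h0 => ?_)
      rw [show h p = 0 from h0, zero_mul] at hgp
      exact lt_irrefl _ hgp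
    · rw [hgSc n hnn₀ p hpS] at hgp
      exact hp hgp
  have hgle : ∀ p, entInt η Q (g n) p ≤ b n p := by
    intro p
    by_cases hpS : p ∈ S n
    · obtain ⟨c, hc, hgc⟩ := hgS n p hpS
      have hc' := abs_le.1 hc
      have hb : b n p = entInt η Q h p + δ n * (K * h p) := by simp [b, hpS]
      rw [hb]
      have e1 : entInt η Q (g n) p = (1 + c) * entInt η Q h p +
          h p * ((1 + c) * Real.log (1 + c)) := by
        rcases (hh0 p).eq_or_lt with h0 | h0
        · simp [entInt, hgc, ← h0]
        · rw [entInt, entInt, hgc, Real.log_mul h0.ne' (by linarith)]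
          ring
      have e2 : entInt η Q h p = h p * (quad Λ p - Real.log (partZ η (Q, Λ))) :=
        entInt_gibbs hd.pos p
      have h1 : (1 + c) * Real.log (1 + c) ≤ 3 / 2 * δ n := by
        have hl := Real.log_le_sub_one_of_pos (show 0 < 1 + c by linarith)
        have : (1 + c) * Real.log (1 + c) ≤ (1 + c) * c :=
          mul_le_mul_of_nonneg_left (by linarith) (by linarith)
        nlinarith [sq_nonneg c]
      have h2 : c * (quad Λ p - Real.log (partZ η (Q, Λ))) ≤
          δ n * (‖Λ‖ + |Real.log (partZ η (Q, Λ))|) := by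
        refine (le_abs_self _).trans ?_
        rw [abs_mul]
        refine mul_le_mul hc ?_ (abs_nonneg _) (by linarith)
        exact (abs_sub _ _).trans (by gcongr; exact abs_quad_le Λ p)
      have h3 := mul_le_mul_of_nonneg_left (add_le_add h1 h2) (hh0 p)
      rw [e1]
      calc (1 + c) * entInt η Q h p + h p * ((1 + c) * Real.log (1 + c))
          = entInt η Q h p + h p * ((1 + c) * Real.log (1 + c) +
            c * (quad Λ p - Real.log (partZ η (Q, Λ)))) := by rw [e2]; ring
        _ ≤ entInt η Q h p + h p * (3 / 2 * δ n +
            δ n * (‖Λ‖ + |Real.log (partZ η (Q, Λ))|)) := by gcongr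
        _ = _ := by simp only [K]; ring
    · have hb : b n p = entInt η Q f p + δ n * (K * h p) := by simp [b, hpS]
      have : entInt η Q (g n) p = entInt η Q f p := by simp only [entInt, hgSc n hnn₀ p hpS]
      rw [hb, this]
      have : 0 ≤ δ n * (K * h p) := by
        have := hh0 p
        positivity
      linarith
  have hge := finiteEntropy_of_le (hgi n) hg0 hglt (hbi n) (Eventually.of_forall hgle)
  refine ⟨g n, 2 * ‖h‖ + n, ⟨hgi n, hg0, hgmass n⟩, hgQ n, hge, ?_,
    (integral_mono hge.integrable (hbi n) hgle).trans_lt hnlt⟩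
  filter_upwards [hf.2.1, hff'] with p hp hpf
  by_cases hpS : p ∈ S n
  · obtain ⟨c, hc, hgc⟩ := hgS n p hpS
    have hc' := abs_le.1 hc
    have h1 : f p ≤ n := by rw [hpf]; exact hpS
    have h2 := (le_abs_self _).trans (h.norm_coe_le_norm p)
    rw [hgc, Real.norm_eq_abs, abs_le]
    have := hh0 p
    constructor <;> nlinarith
  · rw [hgSc n hnn₀ p hpS, sub_self, norm_zero]
    positivity

/-- An `L^∞`-local minimiser of the energy at fixed Q-tensor is a Gibbs density. -/
theorem ae_eq_gibbs_of_localMin {η : ℝ} {Q Λ : SymZ} (hd : IsDual η Q Λ) {f : S2 → ℝ}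
    (hf : IsDensity f) (hQ : qTensor f = Q) (hfe : FiniteEntropy η Q f) {ε : ℝ} (hε : 0 < ε)
    (hmin : ∀ g, IsDensity g → qTensor g = Q →
      eLpNorm (fun p => g p - f p) ⊤ surf < ENNReal.ofReal ε → energy η f ≤ energy η g) :
    f =ᵐ[surf] gibbs η Q Λ := by
  obtain ⟨hle, heq⟩ := gibbs_inequality hf hQ hfe Λ
  refine heq (hle.eq_or_lt.elim Eq.symm fun hlt => ?_)
  exfalso
  obtain ⟨g, B, hg, hgQ, hge, hB, hglt⟩ := exists_bounded_competitor hd hf hfe hlt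
  have hB1 : 0 < |B| + 1 := by positivity
  let t : ℝ := min 1 (ε / (2 * (|B| + 1)))
  have ht0 : 0 < t := lt_min one_pos (by positivity)
  have ht1 : t ≤ 1 := min_le_left _ _
  obtain ⟨h1, h2⟩ := FiniteEntropy.convex hf hg hfe hge ht0.le ht1
  have hQt := qTensor_convex hf.1 hg.1 (hgQ.trans hQ.symm) t
  have h3 := hmin _ (hf.convex hg ht0.le ht1) (hQt.trans hQ) ?_
  · rw [energy_eq (by rwa [hQ]), energy_eq (by rwa [hQt, hQ]), EReal.coe_le_coe_iff, hQt, hQ] at h3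
    nlinarith
  · rw [eLpNorm_exponent_top]
    have hle : ∀ᵐ p ∂surf, ‖(1 - t) * f p + t * g p - f p‖ ≤ ε / 2 := by
      filter_upwards [hB] with p hp
      rw [show (1 - t) * f p + t * g p - f p = t * (g p - f p) by ring, norm_mul,
        Real.norm_of_nonneg ht0.le]
      calc t * ‖g p - f p‖ ≤ ε / (2 * (|B| + 1)) * (|B| + 1) :=
            mul_le_mul (min_le_right _ _) (hp.trans ((le_abs_self B).trans (by linarith)))
              (norm_nonneg _) (by positivity)
        _ = ε / 2 := by field_simp
    refine (eLpNormEssSup_le_of_ae_bound hle).trans_lt ?_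
    rw [ENNReal.ofReal_lt_ofReal_iff hε]
    linarith

/-! ### Local minimisers of the free energy and of the macroscopic energy -/

theorem qTensor_congr_ae {f g : S2 → ℝ} (h : f =ᵐ[surf] g) : qTensor f = qTensor g := by
  refine integral_congr_ae ?_
  filter_upwards [h] with p hp
  rw [hp]

theorem energy_congr_ae {η : ℝ} {f g : S2 → ℝ} (h : f =ᵐ[surf] g) : energy η f = energy η g := by
  have hQ : qTensor f = qTensor g := qTensor_congr_ae h
  have he : entInt η (qTensor g) f =ᵐ[surf] entInt η (qTensor g) g := by
    filter_upwards [h] with p hp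
    rw [entInt, entInt, hp]
  have hiff : FiniteEntropy η (qTensor f) f ↔ FiniteEntropy η (qTensor g) g := by
    rw [hQ]
    constructor
    · rintro ⟨h1, h2⟩
      refine ⟨?_, h2.congr he⟩
      filter_upwards [h, h1] with p hp hp1
      rwa [← hp]
    · rintro ⟨h1, h2⟩
      refine ⟨?_, h2.congr he.symm⟩
      filter_upwards [h, h1] with p hp hp1
      rwa [hp]
  by_cases hf : FiniteEntropy η (qTensor f) f
  · rw [energy_eq hf, energy_eq (hiff.1 hf), hQ, integral_congr_ae he]
  · have h1 := mt energy_lt_top_iff.1 hf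
    have h2 := mt energy_lt_top_iff.1 (mt hiff.2 hf)
    rw [not_lt_top_iff.1 h1, not_lt_top_iff.1 h2]

theorem energyT_congr_ae {η τ : ℝ} {f g : S2 → ℝ} (h : f =ᵐ[surf] g) :
    energyT η τ f = energyT η τ g := by
  rw [energyT, energyT, energy_congr_ae h, qTensor_congr_ae h]

theorem energyT_lt_top_iff {η τ : ℝ} {f : S2 → ℝ} :
    energyT η τ f < ⊤ ↔ FiniteEntropy η (qTensor f) f := by
  rw [← energy_lt_top_iff, energyT]
  constructor
  · intro h
    by_contra hn
    rw [not_lt_top_iff.1 hn, EReal.top_sub_coe] at h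
    exact lt_irrefl _ h
  · intro h
    rw [energy_eq (energy_lt_top_iff.1 h), ← EReal.coe_sub]
    exact EReal.coe_lt_top _

theorem energyT_eq {η τ : ℝ} {f : S2 → ℝ} (h : FiniteEntropy η (qTensor f) f) :
    energyT η τ f = ((∫ p, entInt η (qTensor f) f p ∂surf -
      1 / (2 * τ) * dot (qTensor f) (qTensor f) : ℝ) : EReal) := by
  rw [energyT, energy_eq h, EReal.coe_sub]

theorem IsDual.energyT_gibbs {η : ℝ} {Q Λ : SymZ} (h : IsDual η Q Λ) (τ : ℝ) :
    energyT η τ (gibbs η Q Λ) = (Jthermal η τ Q : ℝ) := by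
  rw [energyT, h.energy_gibbs, h.qTensor_gibbs, ← EReal.coe_sub, Jthermal, h.Jreal_eq]

theorem Jthermal_le_energyT {η τ : ℝ} {f : S2 → ℝ} (hf : IsDensity f) :
    energyT η τ f = ⊤ ∨ qTensor f ∈ domJ η ∧ (Jthermal η τ (qTensor f) : EReal) ≤ energyT η τ f := by
  by_cases hfe : FiniteEntropy η (qTensor f) f
  · obtain ⟨Λ, h⟩ := exists_isDual hf rfl hfe.lt
    refine Or.inr ⟨h.mem_domJ, ?_⟩
    have h1 := h.dualG_le_energy hf rfl
    rw [energy_eq hfe, EReal.coe_le_coe_iff] at h1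
    rw [energyT_eq hfe, EReal.coe_le_coe_iff, Jthermal, h.Jreal_eq]
    linarith
  · exact Or.inl (not_lt_top_iff.1 (mt energyT_lt_top_iff.1 hfe))

theorem IsLpLocalMin.mono_exponent {η τ : ℝ} {r s : ℝ≥0∞} (hrs : r ≤ s) {f : S2 → ℝ}
    (h : IsLpLocalMin η τ r f) : IsLpLocalMin η τ s f := by
  obtain ⟨hf, hfin, ε, hε, hmin⟩ := h
  let c : ℝ≥0∞ := surf Set.univ ^ (1 / r.toReal - 1 / s.toReal)
  have hc : c ≠ ⊤ := by
    refine ENNReal.rpow_ne_top_of_ne_zero ?_ (measure_ne_top _ _)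
    intro h0
    have := surf_real_univ
    rw [Measure.real, h0, ENNReal.toReal_zero] at this
    exact (by positivity : (4 * Real.pi) ≠ 0) this.symm
  refine ⟨hf, hfin, ε / (c.toReal + 1), by positivity, fun g hg hlt => hmin g hg ?_⟩
  refine (eLpNorm_le_eLpNorm_mul_rpow_measure_univ hrs
    (hg.1.sub hf.1).aestronglyMeasurable).trans_lt ?_
  have h1 : eLpNorm (fun p => g p - f p) s surf * c ≤
      ENNReal.ofReal (ε / (c.toReal + 1)) * c := by gcongr
  refine h1.trans_lt ?_
  rw [← ENNReal.ofReal_toReal hc, ← ENNReal.ofReal_mul (by positivity),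
    ENNReal.ofReal_lt_ofReal_iff hε]
  simp only [ENNReal.toReal_ofReal ENNReal.toReal_nonneg]
  have h2 : 0 ≤ c.toReal := ENNReal.toReal_nonneg
  rw [div_mul_eq_mul_div, div_lt_iff₀ (by positivity)]
  nlinarith

theorem continuousAt_gibbs {η : ℝ} {Q Λ : SymZ} (h : 0 < partZ η (Q, Λ)) :
    ContinuousAt (fun x : SymZ × SymZ => gibbs η x.1 x.2) (Q, Λ) := by
  have h1 : ContinuousAt (fun x : SymZ × SymZ => (partZ η x)⁻¹) (Q, Λ) :=
    (continuous_partZ η).continuousAt.inv₀ h.ne'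
  have h2 : Continuous fun x : SymZ × SymZ => wC η x.1 * expC x.2 :=
    ((continuous_wC η).comp continuous_fst).mul
      ((contDiff_expC (n := 0)).continuous.comp continuous_snd)
  exact h1.smul h2.continuousAt

theorem tendsto_gibbs {η : ℝ} {Q Λ : SymZ} (h : 0 < partZ η (Q, Λ)) {L : SymZ → SymZ}
    (hL : Tendsto L (𝓝 Q) (𝓝 Λ)) :
    Tendsto (fun Q' => gibbs η Q' (L Q')) (𝓝 Q) (𝓝 (gibbs η Q Λ)) := by
  have h1 : Tendsto (fun x : SymZ × SymZ => gibbs η x.1 x.2) (𝓝 (Q, Λ)) (𝓝 (gibbs η Q Λ)) :=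
    continuousAt_gibbs h
  have h2 : Tendsto (fun Q' => (Q', L Q')) (𝓝 Q) (𝓝 (Q, Λ)) := tendsto_id.prodMk_nhds hL
  have h3 := h1.comp h2
  exact h3

theorem IsLpLocalMin.ae_eq_gibbs {η τ : ℝ} {f : S2 → ℝ} (h : IsLpLocalMin η τ ⊤ f) {Λ : SymZ}
    (hd : IsDual η (qTensor f) Λ) : f =ᵐ[surf] gibbs η (qTensor f) Λ := by
  obtain ⟨hf, hfin, ε, hε, hmin⟩ := h
  have hfe := energyT_lt_top_iff.1 hfin
  refine ae_eq_gibbs_of_localMin hd hf rfl hfe hε fun g hg hQ hlt => ?_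
  by_cases hge : FiniteEntropy η (qTensor g) g
  · have h1 := hmin g hg hlt
    rw [energyT_eq hfe, energyT_eq hge, EReal.coe_le_coe_iff, hQ] at h1
    rw [energy_eq hfe, energy_eq hge, EReal.coe_le_coe_iff, hQ]
    linarith
  · rw [not_lt_top_iff.1 (mt energy_lt_top_iff.1 hge)]
    exact le_top

theorem eLpNorm_top_lt {f g : S2 → ℝ} {a b : C(S2, ℝ)} {ε : ℝ} (hf : f =ᵐ[surf] a)
    (hg : g =ᵐ[surf] b) (h : dist b a < ε) :
    eLpNorm (fun p => g p - f p) ⊤ surf < ENNReal.ofReal ε := by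
  rw [eLpNorm_exponent_top]
  have hle : ∀ᵐ p ∂surf, ‖g p - f p‖ ≤ dist b a := by
    filter_upwards [hf, hg] with p hp hp'
    rw [hp, hp', ← dist_eq_norm]
    exact ContinuousMap.dist_apply_le_dist p
  refine (eLpNormEssSup_le_of_ae_bound hle).trans_lt ?_
  rwa [ENNReal.ofReal_lt_ofReal_iff (dist_nonneg.trans_lt h)]

/-- The Q-tensor of a local minimiser of the free energy is a local minimiser of the macroscopic
energy, since the Gibbs densities depend continuously on `Q` in the uniform norm. -/
theorem IsLpLocalMin.isLocalMin_Jthermal {η τ : ℝ} {f : S2 → ℝ} (h : IsLpLocalMin η τ ⊤ f)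
    {Λ : SymZ} (hd : IsDual η (qTensor f) Λ) : IsLocalMin (Jthermal η τ) (qTensor f) := by
  have heq := h.ae_eq_gibbs hd
  obtain ⟨hf, hfin, ε, hε, hmin⟩ := h
  obtain ⟨L, hL, hLd⟩ := hd.exists_branch
  have hball := Metric.tendsto_nhds.1 (tendsto_gibbs hd.pos hL) ε hε
  filter_upwards [hLd, hball] with Q' h1 h2
  have h3 := hmin _ (isDensity_gibbs h1.pos) (eLpNorm_top_lt heq (EventuallyEq.refl _ _) h2)
  rwa [h1.energyT_gibbs, energyT_congr_ae heq, hd.energyT_gibbs, EReal.coe_le_coe_iff] at h3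

theorem norm_qTensor_sub_le {f g : S2 → ℝ} (hf : Integrable f surf) (hg : Integrable g surf) :
    ‖qTensor g - qTensor f‖ ≤ ∫ p, ‖g p - f p‖ ∂surf := by
  rw [qTensor, qTensor, ← integral_sub (integrable_smul_mom hg) (integrable_smul_mom hf)]
  refine norm_integral_le_of_norm_le (hg.sub hf).norm (Eventually.of_forall fun p => ?_)
  rw [← sub_smul, norm_smul]
  exact mul_le_of_le_one_right (norm_nonneg _) (norm_mom_le p)

/-- The Gibbs density of a local minimiser of the macroscopic energy is an `L¹`-local minimiser of
the free energy, as the Q-tensor is continuous in `L¹`. -/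
theorem IsDual.isLpLocalMin_one {η τ : ℝ} {Q Λ : SymZ} (hd : IsDual η Q Λ)
    (hmin : IsLocalMin (Jthermal η τ) Q) {f : S2 → ℝ} (hf : IsDensity f)
    (heq : f =ᵐ[surf] gibbs η Q Λ) : IsLpLocalMin η τ 1 f := by
  have hQ : qTensor f = Q := (qTensor_congr_ae heq).trans hd.qTensor_gibbs
  have hE : energyT η τ f = (Jthermal η τ Q : ℝ) := by
    rw [energyT_congr_ae heq, hd.energyT_gibbs]
  obtain ⟨ε, hε, hball⟩ := Metric.eventually_nhds_iff.1 hmin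
  refine ⟨hf, by rw [hE]; exact EReal.coe_lt_top _, ε, hε, fun g hg hlt => ?_⟩
  rcases Jthermal_le_energyT (η := η) (τ := τ) hg with h1 | ⟨-, h1⟩
  · rw [h1]
    exact le_top
  · refine le_trans ?_ h1
    rw [hE, EReal.coe_le_coe_iff]
    refine hball ?_
    rw [dist_eq_norm, ← hQ]
    refine (norm_qTensor_sub_le hf.1 hg.1).trans_lt ?_
    rw [integral_norm_eq_lintegral_enorm (f := fun p => g p - f p)
        (hg.1.sub hf.1).aestronglyMeasurable,
      ← eLpNorm_one_eq_lintegral_enorm]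
    exact (ENNReal.lt_ofReal_iff_toReal_lt hlt.ne_top).1 hlt

/-- For every exponent, the local minimisers of the free energy are the Gibbs densities of the local
minimisers of the macroscopic energy. -/
theorem isLpLocalMin_iff {η τ : ℝ} {r : ℝ≥0∞} (hr : 1 ≤ r) {f : S2 → ℝ} :
    IsLpLocalMin η τ r f ↔ IsDensity f ∧ ∃ Λ, IsDual η (qTensor f) Λ ∧
      f =ᵐ[surf] gibbs η (qTensor f) Λ ∧ IsLocalMin (Jthermal η τ) (qTensor f) := by
  constructor
  · intro h
    obtain ⟨Λ, hd⟩ := exists_isDual h.1 rfl (energyT_lt_top_iff.1 h.2.1).lt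
    have h' := h.mono_exponent le_top
    exact ⟨h.1, Λ, hd, h'.ae_eq_gibbs hd, h'.isLocalMin_Jthermal hd⟩
  · rintro ⟨hf, Λ, hd, heq, hmin⟩
    exact (hd.isLpLocalMin_one hmin hf heq).mono_exponent hr

/-! ### The envelope theorem and the saddle point property -/

/-- The derivative of the macroscopic energy at `Q`, in terms of the dual variable. -/
def gradJ (η : ℝ) (Q Λ : SymZ) : SymZ →L[ℝ] ℝ :=
  dotL Λ - (partZ η (Q, Λ))⁻¹ • (wIntD η Q).flip (expC Λ)

theorem gradJ_apply (η : ℝ) (Q Λ A : SymZ) :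
    gradJ η Q Λ A = dot Λ A - (partZ η (Q, Λ))⁻¹ * wIntD η Q A (expC Λ) := rfl

theorem IsDual.hasStrictFDerivAt_dualG {η : ℝ} {Q Λ : SymZ} (h : IsDual η Q Λ) :
    HasStrictFDerivAt (dualG η) ((gradJ η Q Λ).comp (ContinuousLinearMap.fst ℝ SymZ SymZ))
      (Q, Λ) := by
  have hs := hasStrictFDerivAt_snd (𝕜 := ℝ) (E := SymZ) (F := SymZ) (p := (Q, Λ))
  have h1 : HasStrictFDerivAt (fun x : SymZ × SymZ => dotL x.1)
      (dotL.comp (ContinuousLinearMap.fst ℝ SymZ SymZ)) (Q, Λ) :=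
    ContinuousLinearMap.hasStrictFDerivAt (dotL.comp (ContinuousLinearMap.fst ℝ SymZ SymZ))
  have h2 := (hasStrictFDerivAt_partZ h.ne_zero_or Λ).log h.pos.ne'
  refine HasStrictFDerivAt.congr_fderiv ((h1.clm_apply hs).sub h2) ?_
  refine ContinuousLinearMap.ext fun x => ?_
  have h3 := h.integral_eq x.2
  have h4 : expC Λ * centered Q x.2 = expC Λ * quadL x.2 - dot Q x.2 • expC Λ := by
    ext p
    simp
    ring
  rw [h4, map_sub, map_smul, smul_eq_mul, sub_eq_zero] at h3
  have h5 : wInt η Q (expC Λ) = partZ η (Q, Λ) := rfl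
  simp [gradJ_apply, h3, h5, dot_comm x.1 Λ]
  have := h.pos.ne'
  field_simp
  ring

/-- The envelope theorem for the macroscopic energy `J(Q) = max_Λ (Q · Λ - ln Z(Q, Λ))`. Both bounds
come from testing the maximum at one point with the maximiser at the other one; they agree to first
order by strict differentiability and continuity of the maximiser. -/
theorem IsDual.hasFDerivAt_Jreal {η : ℝ} {Q Λ : SymZ} (h : IsDual η Q Λ) :
    HasFDerivAt (Jreal η) (gradJ η Q Λ) Q := by
  obtain ⟨L, hL, hLd⟩ := h.exists_branch
  have hs := h.hasStrictFDerivAt_dualG.isLittleO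
  have t1 : Tendsto (fun Q' => (((Q', L Q'), (Q, L Q')) : (SymZ × SymZ) × (SymZ × SymZ))) (𝓝 Q)
      (𝓝 ((Q, Λ), (Q, Λ))) :=
    (tendsto_id.prodMk_nhds hL).prodMk_nhds (tendsto_const_nhds.prodMk_nhds hL)
  have t2 : Tendsto (fun Q' => (((Q', Λ), (Q, Λ)) : (SymZ × SymZ) × (SymZ × SymZ))) (𝓝 Q)
      (𝓝 ((Q, Λ), (Q, Λ))) :=
    (tendsto_id.prodMk_nhds tendsto_const_nhds).prodMk_nhds tendsto_const_nhds
  have o1 := (hs.comp_tendsto t1).norm_norm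
  have o2 := (hs.comp_tendsto t2).norm_norm
  simp only [Function.comp_def, Prod.mk_sub_mk, sub_self, ContinuousLinearMap.comp_apply,
    ContinuousLinearMap.coe_fst', Prod.norm_mk, norm_zero] at o1 o2
  rw [hasFDerivAt_iff_isLittleO]
  have o3 := o1.add o2
  refine Asymptotics.IsLittleO.of_norm_right (Asymptotics.IsBigO.trans_isLittleO
    (Asymptotics.IsBigO.of_bound 1 ?_) (o3.congr_right fun Q' => max_eq_left (norm_nonneg _)))
  filter_upwards [hLd] with Q' hd
  rw [hd.Jreal_eq, h.Jreal_eq, one_mul]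
  have h1 := h.dualG_le (L Q')
  have h2 := hd.dualG_le Λ
  set a := dualG η (Q', L Q') - dualG η (Q, L Q') - gradJ η Q Λ (Q' - Q) with ha
  set b := dualG η (Q', Λ) - dualG η (Q, Λ) - gradJ η Q Λ (Q' - Q) with hb
  rw [Real.norm_eq_abs, Real.norm_of_nonneg (by positivity), Real.norm_eq_abs, Real.norm_eq_abs,
    abs_le]
  constructor
  · linarith [neg_abs_le b, abs_nonneg a]
  · linarith [le_abs_self a, abs_nonneg b]

theorem hasFDerivAt_dot_self (τ : ℝ) (Q : SymZ) :
    HasFDerivAt (fun Q => 1 / (2 * τ) * dot Q Q) ((1 / τ) • dotL Q) Q := by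
  have h := ((dotL.hasFDerivAt (x := Q)).clm_apply (hasFDerivAt_id Q)).const_mul (1 / (2 * τ))
  refine HasFDerivAt.congr_fderiv h ?_
  ext A
  simp [dot_comm A Q]
  ring

theorem IsDual.hasFDerivAt_Jthermal {η : ℝ} {Q Λ : SymZ} (h : IsDual η Q Λ) (τ : ℝ) :
    HasFDerivAt (Jthermal η τ) (gradJ η Q Λ - (1 / τ) • dotL Q) Q :=
  h.hasFDerivAt_Jreal.sub (hasFDerivAt_dot_self τ Q)

theorem IsDual.hasFDerivAt_dualF {η : ℝ} {Q Λ : SymZ} (h : IsDual η Q Λ) (τ : ℝ) :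
    HasFDerivAt (dualF η τ)
      ((gradJ η Q Λ - (1 / τ) • dotL Q).comp (ContinuousLinearMap.fst ℝ SymZ SymZ)) (Q, Λ) := by
  have h1 : HasFDerivAt (fun x : SymZ × SymZ => 1 / (2 * τ) * dot x.1 x.1)
      (((1 / τ) • dotL Q).comp (ContinuousLinearMap.fst ℝ SymZ SymZ)) (Q, Λ) :=
    HasFDerivAt.comp (Q, Λ) (g := fun Q => 1 / (2 * τ) * dot Q Q) (hasFDerivAt_dot_self τ Q)
      (hasFDerivAt_fst (𝕜 := ℝ) (E := SymZ) (F := SymZ) (p := (Q, Λ)))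
  rw [show dualF η τ = fun x => dualG η x - 1 / (2 * τ) * dot x.1 x.1 from
    funext (dualF_eq η τ)]
  exact h.hasStrictFDerivAt_dualG.hasFDerivAt.sub h1

theorem IsDual.isSaddlePoint {η τ : ℝ} {Q Λ : SymZ} (h : IsDual η Q Λ)
    (hmin : IsLocalMin (Jthermal η τ) Q) : IsSaddlePoint (dualF η τ) (domJ η) Q Λ where
  mem := h.mem_domJ
  nhds := (isOpen_domJ η).mem_nhds h.mem_domJ
  critical := by
    have := h.hasFDerivAt_dualF τ
    rwa [hmin.hasFDerivAt_eq_zero (h.hasFDerivAt_Jthermal τ), ContinuousLinearMap.zero_comp] at this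
  max M := by
    rw [dualF_eq, dualF_eq]
    exact sub_le_sub_right (h.dualG_le M) _
  min := by
    filter_upwards [hmin.filter_mono nhdsWithin_le_nhds, self_mem_nhdsWithin] with Q₀ h1 hQ₀
    obtain ⟨M₀, h0⟩ := mem_domJ_iff.1 hQ₀
    refine ⟨M₀, fun M => ?_, ?_⟩
    · rw [dualF_eq, dualF_eq]
      exact sub_le_sub_right (h0.dualG_le M) _
    · rwa [Jthermal, Jthermal, h.Jreal_eq, h0.Jreal_eq, ← dualF_eq η τ (Q, Λ),
        ← dualF_eq η τ (Q₀, M₀)] at h1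

theorem IsDual.solvesEulerLagrange {η τ : ℝ} {f : S2 → ℝ} {Λ : SymZ}
    (h : IsDual η (qTensor f) Λ) (heq : f =ᵐ[surf] gibbs η (qTensor f) Λ)
    (hmin : IsLocalMin (Jthermal η τ) (qTensor f)) :
    SolvesEulerLagrange η τ f (qTensor f) Λ := by
  set Q := qTensor f with hQ
  let U : Set S2 := {p | η < quad Q p}
  have hU : MeasurableSet U := measurableSet_lt_quad η Q
  let k : S2 → ℝ := U.indicator fun p => (partZ η (Q, Λ))⁻¹ * expC Λ p
  have hk : Integrable k surf := ((integrable_continuousMap surf (expC Λ)).const_mul _).indicator hU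
  have hfk : (fun p => (f p / (quad Q p - η)) • mom p) =ᵐ[surf] fun p => k p • mom p := by
    filter_upwards [heq] with p hp
    rw [hp]
    congr 1
    by_cases hpU : p ∈ U
    · have h1 : 0 < quad Q p - η := sub_pos.2 hpU
      rw [gibbs_apply, max_eq_left h1.le, show k p = (partZ η (Q, Λ))⁻¹ * expC Λ p from
        Set.indicator_of_mem hpU _, expC_apply]
      field_simp
    · have h1 : quad Q p - η ≤ 0 := sub_nonpos.2 (not_lt.1 hpU)
      rw [gibbs_apply, max_eq_right h1, show k p = 0 from Set.indicator_of_notMem hpU _]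
      simp
  have hki := integrable_smul_mom hk
  refine ⟨⟨partZ η (Q, Λ), h.pos, ?_⟩, hQ, hki.congr hfk.symm, ?_⟩
  · filter_upwards [heq] with p hp
    rw [hp, gibbs_apply]
  · rw [integral_congr_ae hfk]
    refine ext_dot fun A => ?_
    have h0 := DFunLike.congr_fun (hmin.hasFDerivAt_eq_zero (h.hasFDerivAt_Jthermal τ)) A
    have h1 : ∫ p, k p * quad A p ∂surf = (partZ η (Q, Λ))⁻¹ * wIntD η Q A (expC Λ) := by
      rw [wIntD_apply, ← integral_const_mul, ← integral_indicator hU]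
      refine integral_congr_ae (Eventually.of_forall fun p => ?_)
      by_cases hpU : p ∈ U
      · simp [k, hpU]
        ring
      · simp [k, hpU]
    simp only [sub_apply, smul_apply, gradJ_apply, dotL_apply, smul_eq_mul, zero_apply] at h0
    rw [dot_add_left, dot_smul_left, dot_integral_smul_mom hki, h1]
    linarith

/-! ### The isotropic state -/

/-- The first coordinate vector. -/
def northPole : S2 := ⟨EuclideanSpace.single 0 1, by simp⟩

instance : Nontrivial SymZ := by
  refine ⟨⟨mom northPole, 0, fun h => ?_⟩⟩
  have h1 : (mom northPole).1 0 0 = (0 : SymZ).1 0 0 := by rw [h]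
  simp [mom, northPole, SymZ.coe_zero] at h1
  norm_num at h1

theorem expC_zero : expC 0 = 1 := by
  ext p
  simp [expC_apply, quad_zero]

theorem wC_zero {η : ℝ} (hη : η < 0) (p : S2) : wC η 0 p = -η := by
  rw [wC_apply, quad_zero, max_eq_left (by linarith)]
  ring

theorem wInt_zero {η : ℝ} (hη : η < 0) (g : C(S2, ℝ)) :
    wInt η 0 g = -η * ∫ p, g p ∂surf := by
  rw [wInt_apply, ← integral_const_mul]
  simp only [wC_zero hη]

theorem partZ_zero {η : ℝ} (hη : η < 0) : partZ η (0, 0) = -(4 * Real.pi * η) := by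
  change wInt η 0 (expC 0) = _
  rw [wInt_zero hη, expC_zero]
  simp [surf_real_univ]
  ring

theorem centered_zero : centered 0 = quadL := by
  refine ContinuousLinearMap.ext fun M => ?_
  ext p
  simp [dot_zero_left]

theorem isDual_zero {η : ℝ} (hη : η < 0) : IsDual η 0 0 := by
  refine ⟨?_, ?_⟩
  · rw [partZ_zero hη]
    nlinarith [Real.pi_pos]
  · refine ContinuousLinearMap.ext fun M => ?_
    rw [defect_apply, wInt_zero hη, expC_zero, centered_zero, one_mul]
    simp [integral_quad]

theorem wIntD_eq {η : ℝ} {Q : SymZ} (hQ : ‖Q‖ < -η) (A : SymZ) (g : C(S2, ℝ)) :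
    wIntD η Q A g = intL surf (g * quadL A) := by
  have hU : {p | η < quad Q p} = Set.univ := by
    refine Set.eq_univ_of_forall fun p => ?_
    have := abs_lt.1 ((abs_quad_le Q p).trans_lt hQ)
    change η < quad Q p
    linarith
  rw [wIntD_apply, hU, Measure.restrict_univ, intL_apply]
  simp [mul_comm]

theorem intL_quadL_mul_quadL (A B : SymZ) :
    intL surf (quadL A * quadL B) = 8 * Real.pi / 15 * dot A B :=
  integral_quad_mul_quad A B

theorem gradJ_zero {η : ℝ} (hη : η < 0) : gradJ η 0 0 = 0 := by
  refine ContinuousLinearMap.ext fun A => ?_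
  rw [gradJ_apply, wIntD_eq (by rw [norm_zero]; linarith), expC_zero, one_mul, dot_zero_left]
  simp [integral_quad]

/-- Smoothness of the macroscopic energy at `0` and its Hessian. The derivative of `J` is given by
the envelope theorem, and the derivative of the dual variable by the linearised stationarity
condition; both involve only the fourth moments of the surface measure. -/
theorem contDiffAt_Jreal_and_hessian {η : ℝ} (hη : η < 0) :
    ContDiffAt ℝ 2 (Jreal η) 0 ∧
      ∀ A B : SymZ, fderiv ℝ (fderiv ℝ (Jreal η)) 0 A B = hessCoeff η * dot A B := by
  have hd0 := isDual_zero hη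
  obtain ⟨L, hL0, hLc, hLd⟩ := exists_smooth_branch hη hd0
  have hpair : ContDiffAt ℝ 2 (fun Q => (Q, L Q)) 0 := contDiffAt_id.prodMk hLc
  have hZc : ContDiffAt ℝ 2 (fun Q => partZ η (Q, L Q)) 0 := by
    refine ContDiffAt.comp (0 : SymZ) (g := partZ η) ?_ hpair
    rw [hL0]
    exact contDiffAt_partZ hη 0
  have hZ0 : partZ η (0, L 0) = -(4 * Real.pi * η) := by rw [hL0, partZ_zero hη]
  have hZne : partZ η (0, L 0) ≠ 0 := by
    rw [hL0]
    exact hd0.pos.ne'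
  have hJ : Jreal η =ᶠ[𝓝 0] fun Q => dotL Q (L Q) - Real.log (partZ η (Q, L Q)) := by
    filter_upwards [hLd] with Q h
    rw [h.Jreal_eq]
    rfl
  have hcJ : ContDiffAt ℝ 2 (Jreal η) 0 := by
    refine ContDiffAt.congr_of_eventuallyEq ?_ hJ
    exact (dotL.contDiff.contDiffAt.clm_apply hLc).sub (hZc.log hZne)
  refine ⟨hcJ, fun B A => ?_⟩
  have hdiff : DifferentiableAt ℝ (fderiv ℝ (Jreal η)) 0 :=
    (hcJ.fderiv_right (m := 1) (by norm_num)).differentiableAt one_ne_zero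
  -- the derivative of `J` in the direction `A`, near `0`
  let E : SymZ → ℝ := fun Λ => intL surf (expC Λ * quadL A)
  have hgrad : (fun Q => fderiv ℝ (Jreal η) Q A) =ᶠ[𝓝 0]
      fun Q => dotL (L Q) A - (partZ η (Q, L Q))⁻¹ * E (L Q) := by
    filter_upwards [hLd, Metric.ball_mem_nhds (0 : SymZ) (neg_pos.2 hη)] with Q h hQ
    rw [h.hasFDerivAt_Jreal.fderiv, gradJ_apply, wIntD_eq (by simpa using hQ)]
    rfl
  have hLD : HasFDerivAt L (fderiv ℝ L 0) 0 := (hLc.differentiableAt two_ne_zero).hasFDerivAt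
  have hED : HasFDerivAt E ((intL surf).comp
      (((ContinuousLinearMap.mul ℝ C(S2, ℝ)).flip (quadL A)).comp
        ((ContinuousLinearMap.mul ℝ C(S2, ℝ) (expC 0)).comp quadL))) (L 0) := by
    rw [hL0]
    exact ((intL surf).comp ((ContinuousLinearMap.mul ℝ C(S2, ℝ)).flip (quadL A))).hasFDerivAt.comp
      (0 : SymZ) (hasStrictFDerivAt_expC 0).hasFDerivAt
  have hE0 : E (L 0) = 0 := by
    simp [E, hL0, expC_zero, integral_quad]
  have hZinv : DifferentiableAt ℝ (fun Q => (partZ η (Q, L Q))⁻¹) 0 :=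
    (hZc.differentiableAt two_ne_zero).inv hZne
  have hder := ((dotL.hasFDerivAt.comp (0 : SymZ) hLD).clm_apply
    (hasFDerivAt_const A (0 : SymZ))).sub (hZinv.hasFDerivAt.mul (hED.comp (0 : SymZ) hLD))
  have h1 : fderiv ℝ (fderiv ℝ (Jreal η)) 0 B A = dot (fderiv ℝ L 0 B) A +
      1 / (4 * Real.pi * η) * (8 * Real.pi / 15 * dot (fderiv ℝ L 0 B) A) := by
    have e1 := (hdiff.hasFDerivAt.clm_apply (hasFDerivAt_const A (0 : SymZ))).fderiv
    have e2 := hder.fderiv.symm.trans (hgrad.fderiv_eq.symm.trans e1)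
    have e3 := DFunLike.congr_fun e2 B
    simp [hE0, hZ0, expC_zero] at e3
    rw [← e3]
    have := intL_quadL_mul_quadL A (fderiv ℝ L 0 B)
    simp only [intL_apply, ContinuousMap.mul_apply, quadL_apply] at this
    rw [this, dot_comm A]
    ring
  -- the linearised stationarity condition
  obtain ⟨N', hN', hN1, hN2⟩ := exists_hasStrictFDerivAt_defect hd0.ne_zero_or 0
  have h2 : N' (B, fderiv ℝ L 0 B) = 0 := by
    have hpd : HasFDerivAt (fun Q => (Q, L Q)) ((ContinuousLinearMap.id ℝ SymZ).prod
      (fderiv ℝ L 0)) 0 := (hasFDerivAt_id (0 : SymZ)).prodMk hLD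
    have hc : HasFDerivAt (fun Q => defect η (Q, L Q)) (N'.comp
        ((ContinuousLinearMap.id ℝ SymZ).prod (fderiv ℝ L 0))) 0 := by
      refine HasFDerivAt.comp (0 : SymZ) (g := defect η) ?_ hpd
      rw [hL0]
      exact hN'.hasFDerivAt
    have hz : (fun Q => defect η (Q, L Q)) =ᶠ[𝓝 0] fun _ => 0 := by
      filter_upwards [hLd] with Q h
      exact h.defect_eq_zero
    have := hc.unique ((hasFDerivAt_const (0 : SymZ →L[ℝ] ℝ) (0 : SymZ)).congr_of_eventuallyEq hz)
    exact DFunLike.congr_fun this B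
  have h3 : N' (B, 0) A + N' (0, fderiv ℝ L 0 B) A = 0 := by
    rw [← add_apply, ← map_add, Prod.mk_add_mk, add_zero, zero_add, h2, zero_apply]
  rw [hN1, hN2] at h3
  simp only [sub_apply, smul_apply, ContinuousLinearMap.comp_apply,
    ContinuousLinearMap.mul_apply', centered_zero, expC_zero, one_mul, dotL_apply, smul_eq_mul] at h3
  rw [wIntD_eq (by rw [norm_zero]; linarith), wInt_zero hη, wInt_zero hη] at h3
  have e4 := intL_quadL_mul_quadL A B
  have e5 := intL_quadL_mul_quadL (fderiv ℝ L 0 B) A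
  rw [intL_apply] at e5
  rw [e4, e5, dot_comm A B] at h3
  simp only [ContinuousMap.one_apply, integral_const, surf_real_univ, smul_eq_mul, mul_one] at h3
  rw [h1, hessCoeff]
  have hπ := Real.pi_pos.ne'
  have hη0 := hη.ne
  have h4 : dot (fderiv ℝ L 0 B) A = (15 / 2 + 1 / η) * dot B A := by
    have : Real.pi * (2 * η * dot (fderiv ℝ L 0 B) A) = Real.pi * ((15 * η + 2) * dot B A) := by
      linarith
    have := mul_left_cancel₀ hπ this
    field_simp
    linarith
  rw [h4]
  field_simp
  ring

/-- A second derivative test: a critical point with positive definite second derivative is a strict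
local minimum. -/
theorem eventually_lt_of_second_deriv {E : Type*} [NormedAddCommGroup E] [NormedSpace ℝ E]
    {φ : E → ℝ} {D : E → E →L[ℝ] ℝ} {D' : E →L[ℝ] E →L[ℝ] ℝ}
    (hφ : ∀ᶠ x in 𝓝 0, HasFDerivAt φ (D x) x) (hD : HasFDerivAt D D' 0) (hD0 : D 0 = 0)
    {κ : ℝ} (hκ : 0 < κ) (hpos : ∀ x, κ * ‖x‖ ^ 2 ≤ D' x x) :
    ∀ᶠ x in 𝓝 0, x ≠ 0 → φ 0 < φ x := by
  have ho := hD.isLittleO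
  simp only [hD0, sub_zero] at ho
  obtain ⟨δ, hδ, hball⟩ := Metric.eventually_nhds_iff_ball.1
    (hφ.and (Asymptotics.isLittleO_iff.1 ho (half_pos hκ)))
  filter_upwards [Metric.ball_mem_nhds (0 : E) hδ] with x hx hx0
  have hmem : ∀ t ∈ Set.Icc (0 : ℝ) 1, t • x ∈ Metric.ball (0 : E) δ := by
    intro t ht
    rw [mem_ball_zero_iff] at hx ⊢
    rw [norm_smul, Real.norm_of_nonneg ht.1]
    exact (mul_le_of_le_one_left (norm_nonneg _) ht.2).trans_lt hx
  have hder : ∀ t ∈ Set.Icc (0 : ℝ) 1, HasDerivAt (fun t : ℝ => φ (t • x)) (D (t • x) x) t := by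
    intro t ht
    have h1 := (hball _ (hmem t ht)).1
    have h2 : HasDerivAt (fun t : ℝ => t • x) ((1 : ℝ) • x) t := (hasDerivAt_id t).smul_const x
    rw [one_smul] at h2
    exact h1.comp_hasDerivAt t h2
  obtain ⟨t, ht, hslope⟩ := exists_hasDerivAt_eq_slope (fun t : ℝ => φ (t • x))
    (fun t => D (t • x) x) one_pos
    (fun t ht => (hder t ht).continuousAt.continuousWithinAt)
    (fun t ht => hder t ⟨ht.1.le, ht.2.le⟩)
  simp only [one_smul, zero_smul, sub_zero, div_one] at hslope
  have h2 := (hball _ (hmem t ⟨ht.1.le, ht.2.le⟩)).2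
  have h3 := (D (t • x) - D' (t • x)).le_opNorm x
  have h4 := hpos x
  have hxn : 0 < ‖x‖ := norm_pos_iff.2 hx0
  rw [norm_smul, Real.norm_of_nonneg ht.1.le] at h2
  have h5 : ‖(D (t • x) - D' (t • x)) x‖ ≤ κ / 2 * (t * ‖x‖) * ‖x‖ :=
    h3.trans (mul_le_mul_of_nonneg_right h2 hxn.le)
  rw [sub_apply, map_smul, smul_apply, smul_eq_mul, Real.norm_eq_abs] at h5
  have h6 := (abs_le.1 h5).1
  have h7 := mul_le_mul_of_nonneg_left h4 ht.1.le
  have h8 : 0 < κ / 2 * (t * ‖x‖) * ‖x‖ := by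
    have := ht.1
    positivity
  nlinarith

theorem gibbs_zero {η : ℝ} (hη : η < 0) : ⇑(gibbs η 0 0) = isotropic := by
  funext p
  have hπ := Real.pi_pos.ne'
  have hη0 := hη.ne
  rw [gibbs_apply, partZ_zero hη, quad_zero, max_eq_left (by linarith), isotropic,
    Real.exp_zero]
  field_simp
  ring

theorem isLpLocalMin_isotropic_iff {η τ : ℝ} (hη : η < 0) {r : ℝ≥0∞} (hr : 1 ≤ r) :
    IsLpLocalMin η τ r isotropic ↔ IsLocalMin (Jthermal η τ) 0 := by
  have hd := isDual_zero hη
  have hQ : qTensor isotropic = 0 := by rw [← gibbs_zero hη, hd.qTensor_gibbs]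
  rw [isLpLocalMin_iff hr, hQ]
  constructor
  · rintro ⟨-, -, -, -, h⟩
    exact h
  · intro h
    refine ⟨?_, 0, hd, ?_, h⟩
    · rw [← gibbs_zero hη]
      exact isDensity_gibbs hd.pos
    · rw [gibbs_zero hη]

theorem Jthermal_derivatives {η : ℝ} (hη : η < 0) (τ : ℝ) :
    ∃ (D : SymZ → SymZ →L[ℝ] ℝ) (D' : SymZ →L[ℝ] SymZ →L[ℝ] ℝ),
      (∀ᶠ Q in 𝓝 0, HasFDerivAt (Jthermal η τ) (D Q) Q) ∧ HasFDerivAt D D' 0 ∧ D 0 = 0 ∧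
      ∀ Q, D' Q Q = (hessCoeff η - 1 / τ) * ‖Q‖ ^ 2 := by
  obtain ⟨hc, hh⟩ := contDiffAt_Jreal_and_hessian hη
  have hd := isDual_zero hη
  refine ⟨fun Q => fderiv ℝ (Jreal η) Q - (1 / τ) • dotL Q,
    fderiv ℝ (fderiv ℝ (Jreal η)) 0 - (1 / τ) • dotL, ?_, ?_, ?_, fun Q => ?_⟩
  · obtain ⟨L, -, hL⟩ := hd.exists_branch
    filter_upwards [hL] with Q h
    rw [h.hasFDerivAt_Jreal.fderiv]
    exact h.hasFDerivAt_Jthermal τ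
  · have hdiff : DifferentiableAt ℝ (fderiv ℝ (Jreal η)) 0 :=
      (hc.fderiv_right (m := 1) (by norm_num)).differentiableAt one_ne_zero
    have h2 : HasFDerivAt (fun Q => (1 / τ) • dotL Q) ((1 / τ) • dotL) (0 : SymZ) :=
      ContinuousLinearMap.hasFDerivAt ((1 / τ) • dotL)
    exact hdiff.hasFDerivAt.sub h2
  · change fderiv ℝ (Jreal η) 0 - (1 / τ) • dotL 0 = 0
    rw [hd.hasFDerivAt_Jreal.fderiv, gradJ_zero hη]
    simp
  · rw [sub_apply, sub_apply, hh, smul_apply, smul_apply, dotL_apply, dot_self_eq_norm_sq,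
      smul_eq_mul]
    ring

theorem tauCrit_lt_iff {η τ : ℝ} (hτ : 0 < τ) :
    tauCrit η < ENNReal.ofReal τ ↔ 0 < hessCoeff η - 1 / τ := by
  have h0 : 0 < 1 / τ := by positivity
  rw [tauCrit, ENNReal.inv_lt_iff_inv_lt, ← ENNReal.ofReal_inv_of_pos hτ, ← one_div,
    ENNReal.ofReal_lt_ofReal_iff_of_nonneg h0.le, sub_pos]

theorem lt_tauCrit_iff {η τ : ℝ} (hτ : 0 < τ) :
    ENNReal.ofReal τ < tauCrit η ↔ 0 < 1 / τ - hessCoeff η := by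
  have h0 : 0 < 1 / τ := by positivity
  rw [tauCrit, ENNReal.lt_inv_iff_lt_inv, ← ENNReal.ofReal_inv_of_pos hτ, ← one_div,
    ENNReal.ofReal_lt_ofReal_iff h0, sub_pos]

theorem isLocalMin_Jthermal_zero {η τ : ℝ} (hη : η < 0) (h : 0 < hessCoeff η - 1 / τ) :
    IsLocalMin (Jthermal η τ) 0 := by
  obtain ⟨D, D', h1, h2, h3, h4⟩ := Jthermal_derivatives hη τ
  have := eventually_lt_of_second_deriv h1 h2 h3 h (fun Q => (h4 Q).ge)
  filter_upwards [this] with Q hQ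
  by_cases h0 : Q = 0
  · rw [h0]
  · exact (hQ h0).le

theorem eventually_Jthermal_lt {η τ : ℝ} (hη : η < 0) (h : 0 < 1 / τ - hessCoeff η) :
    ∀ᶠ Q in 𝓝 0, Q ≠ 0 → Jthermal η τ Q < Jthermal η τ 0 := by
  obtain ⟨D, D', h1, h2, h3, h4⟩ := Jthermal_derivatives hη τ
  have := eventually_lt_of_second_deriv (φ := fun Q => -Jthermal η τ Q) (D := fun Q => -D Q)
    (D' := -D') (h1.mono fun Q hQ => hQ.neg) h2.neg (by rw [h3, neg_zero]) h
    (fun Q => by rw [neg_apply, neg_apply, h4]; linarith)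
  filter_upwards [this] with Q hQ h0
  exact neg_lt_neg_iff.1 (hQ h0)

end

end ThermalNematic

open ThermalNematic in
theorem mainTheorem8 (η τ : ℝ) (hτ : 0 < τ) :
    -- local minimality does not depend on the exponent
    (∀ (f : S2 → ℝ) (r s : ℝ≥0∞), 1 ≤ r → 1 ≤ s →
      IsLpLocalMin η τ r f → IsLpLocalMin η τ s f) ∧
    -- Euler–Lagrange system and saddle point property of local minimisers
    (∀ (f : S2 → ℝ) (r : ℝ≥0∞), 1 ≤ r → IsLpLocalMin η τ r f →
      ∃ Q Λ : SymZ, SolvesEulerLagrange η τ f Q Λ ∧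
        IsSaddlePoint (dualF η τ) (domJ η) Q Λ) ∧
    -- the isotropic state
    (η < 0 →
      domJ η ∈ 𝓝 (0 : SymZ) ∧
      ContDiffAt ℝ 2 (Jreal η) 0 ∧
      (∀ A B : SymZ, fderiv ℝ (fderiv ℝ (Jreal η)) 0 A B = hessCoeff η * dot A B) ∧
      HasFDerivAt (Jthermal η τ) (0 : SymZ →L[ℝ] ℝ) 0 ∧
      (tauCrit η < ENNReal.ofReal τ →
        IsLocalMinOn (Jthermal η τ) (domJ η) 0 ∧
        ∀ r : ℝ≥0∞, 1 ≤ r → IsLpLocalMin η τ r isotropic) ∧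
      (ENNReal.ofReal τ < tauCrit η →
        IsLocalMaxOn (Jthermal η τ) (domJ η) 0 ∧
        ∀ r : ℝ≥0∞, 1 ≤ r → ¬ IsLpLocalMin η τ r isotropic)) := by
  refine ⟨fun f r s hr hs h => (isLpLocalMin_iff hs).2 ((isLpLocalMin_iff hr).1 h), ?_, ?_⟩
  · intro f r hr h
    obtain ⟨-, Λ, hd, heq, hmin⟩ := (isLpLocalMin_iff hr).1 h
    exact ⟨qTensor f, Λ, hd.solvesEulerLagrange heq hmin, hd.isSaddlePoint hmin⟩
  · intro hη
    have hd := isDual_zero hη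
    obtain ⟨hc, hh⟩ := contDiffAt_Jreal_and_hessian hη
    refine ⟨(isOpen_domJ η).mem_nhds hd.mem_domJ, hc, hh, ?_, fun h => ?_, fun h => ?_⟩
    · have := hd.hasFDerivAt_Jthermal τ
      rwa [gradJ_zero hη, map_zero, smul_zero, sub_zero] at this
    · have hmin := isLocalMin_Jthermal_zero hη ((tauCrit_lt_iff hτ).1 h)
      exact ⟨hmin.on _, fun r hr => (isLpLocalMin_isotropic_iff hη hr).2 hmin⟩
    · have hlt := eventually_Jthermal_lt hη ((lt_tauCrit_iff hτ).1 h)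
      constructor
      · have hmax : IsLocalMax (Jthermal η τ) 0 := by
          filter_upwards [hlt] with Q hQ
          by_cases h0 : Q = 0
          · rw [h0]
          · exact (hQ h0).le
        exact hmax.on _
      · intro r hr hmin
        have hmin' := (isLpLocalMin_isotropic_iff hη hr).1 hmin
        have h1 : ∀ᶠ Q in 𝓝[≠] (0 : SymZ), False := by
          filter_upwards [hlt.filter_mono nhdsWithin_le_nhds,
            hmin'.filter_mono nhdsWithin_le_nhds, self_mem_nhdsWithin] with Q h2 h3 h4
          exact absurd (h2 h4) (not_lt.2 h3)
        have : (𝓝[≠] (0 : SymZ)).NeBot := Module.punctured_nhds_neBot ℝ SymZ 0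
        exact h1.exists.elim fun _ h => h
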